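/- **Conventions.** A polyhedron is the convex hull $X\subset\mathbb{R}^n$ of a finite set of points; a linear triangulation of $X$ is a finite simplicial complex with underlying set $X$. A map between polyhedra is piecewise linear (PL) if it is the restriction of an affine map on each simplex of some linear triangulation of its source. For a finite-dimensional real vector space $\mathfrak{g}$, a piecewise smooth $\mathfrak{g}$-valued $1$-form $\alpha$ on $X$, written $\alpha\in\Omega^1_{\mathrm{pws}}(X)\otimes\mathfrak{g}$, is given by a linear triangulation $\{X_j\}$ of $X$ and forms $\alpha_j$ on the simplices $X_j$, each extending to a smooth form on an open neighbourhood of $X_j$, such that $\alpha_k|_{X_j}=\alpha_j$ whenever $X_j\subset X_k$; two such families are identified if they agree on a common subdivision. Such forms pull back along PL maps. Let $I^1=[0,1]$, with coordinate function $t_1$. Let $G$ be a finite-dimensional real Lie group with Lie algebra $\mathfrak{g}$ and exponential map $\exp_G$. For $\beta\in\Omega^1_{\mathrm{pws}}(I^1)\otimes\mathfrak{g}$ put $\mathrm{RP}_0(\beta|I^1)=\exp_G(\tilde\beta(\tfrac12))$ if $\tfrac12$ lies in the interior of a segment in $I^1$ on which $\beta=\tilde\beta\,dt_1$ is smooth,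 and $\mathrm{RP}_0(\beta|I^1)=1$ otherwise. For a PL map $\sigma:I^1\to X$ and $\alpha\in\Omega^1_{\mathrm{pws}}(X)\otimes\mathfrak{g}$ put $\mathrm{RP}_0(\alpha|\sigma)=\mathrm{RP}_0(\sigma^*\alpha|I^1)$ and $$\mathrm{RP}_k(\alpha|\sigma)=\prod_{i=1}^{2^k}\mathrm{RP}_0(\alpha|\sigma\circ\sigma^k_i),\qquad \sigma^k_i(t)=\frac{i-1+t}{2^k},$$ the product being taken in the order of increasing $i$. A string in $X$ is a finite (possibly empty) sequence $\sigma=(\sigma_1,\dots,\sigma_m)$ of PL maps $\sigma_i:I^1\to X$ with $\sigma_i(1)=\sigma_{i+1}(0)$ for all $i<m$. Write $\sigma*\tau$ for the concatenation of two strings such that $\tau$ starts where $\sigma$ ends (no condition if one of them is empty). For a PL map $\sigma:I^1\to X$ let $\sigma^{-1}(t)=\sigma(1-t)$, and for a string let $\sigma^{-1}=(\sigma_m^{-1},\dots,\sigma_1^{-1})$. **Theorem.** Let $G$ be a Lie group with Lie algebra $\mathfrak{g}$, let $X$ be a polyhedron and let $\alpha\in\Omega^1_{\mathrm{pws}}(X)\otimes\mathfrak{g}$.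 1. For every PL map $\sigma:I^1\to X$ the limit $\mathrm{MI}(\alpha|\sigma):=\lim_{k\to\infty}\mathrm{RP}_k(\alpha|\sigma)$ exists in $G$. For a string put $\mathrm{MI}(\alpha|\sigma):=\prod_{i=1}^m\mathrm{MI}(\alpha|\sigma_i)$. 2. For every PL map $\sigma:I^1\to X$ and every $k\ge0$, $\mathrm{MI}(\alpha|\sigma)=\prod_{i=1}^{2^k}\mathrm{MI}(\alpha|\sigma\circ\sigma^k_i)$. 3. $\mathrm{MI}(\alpha|\sigma*\tau)=\mathrm{MI}(\alpha|\sigma)\cdot\mathrm{MI}(\alpha|\tau)$ for all strings $\sigma,\tau$ in $X$ such that $\tau$ starts where $\sigma$ ends. 4. $\mathrm{MI}(\alpha|\sigma^{-1})=\mathrm{MI}(\alpha|\sigma)^{-1}$ for every PL map $\sigma:I^1\to X$ and for every string $\sigma$ in $X$. 5. Let $\Phi:G\to H$ be a map of Lie groups with induced Lie algebra map $\phi=\mathrm{Lie}(\Phi)$, and let $f:Y\to X$ be a PL map of polyhedra. For every PL map $\sigma:I^1\to Y$ the Riemann products $\mathrm{RP}_k((f^*\otimes\phi)(\alpha)|\sigma)$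 converge in $H$, and $$\Phi\bigl(\mathrm{MI}(\alpha|f\circ\sigma)\bigr)=\mathrm{MI}\bigl((f^*\otimes\phi)(\alpha)\,|\,\sigma\bigr).$$ The same identity holds for every string $\sigma=(\sigma_1,\dots,\sigma_m)$ in $Y$, with $f\circ\sigma=(f\circ\sigma_1,\dots,f\circ\sigma_m)$. -/

import Mathlib

open scoped Manifold ContDiff Topology
open Filter Set

noncomputable section

/-! ### Polyhedra, triangulations, piecewise linear maps -/

section Polyhedra

variable {V : Type*} [NormedAddCommGroup V] [NormedSpace ℝ V]
  {W : Type*} [NormedAddCommGroup W] [NormedSpace ℝ W]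
  {E : Type*} [NormedAddCommGroup E] [NormedSpace ℝ E]
  {F : Type*} [NormedAddCommGroup F] [NormedSpace ℝ F]

/-- An (embedded) polyhedron: the convex hull of a finite set of points. -/
def IsPolyhedron (X : Set V) : Prop :=
  ∃ S : Set V, S.Finite ∧ X = convexHull ℝ S

/-- A linear triangulation of `X`: a finite simplicial complex with underlying set `X`. -/
def IsTriangulation (T : Geometry.SimplicialComplex ℝ V) (X : Set V) : Prop :=
  T.faces.Finite ∧ T.space = X

/-- A piecewise linear map `Y → X` between polyhedra: it is the restriction of an affine map on
each simplex of some linear triangulation of `Y`. A map on `Y` is represented by a function on the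
ambient space, whose values off `Y` are irrelevant. -/
def IsPLMap (Y : Set W) (X : Set V) (f : W → V) : Prop :=
  MapsTo f Y X ∧ ∃ T : Geometry.SimplicialComplex ℝ W, IsTriangulation T Y ∧
    ∀ s ∈ T.faces, ∃ g : W →ᵃ[ℝ] V, EqOn f g (convexHull ℝ (s : Set W))

/-- The segment from `x` in direction `v` initially stays in `Z`; for a polyhedron `Z` this says
that `x ∈ Z` and that `v` lies in the tangent cone of `Z` at `x`. -/
def PointsInto (Z : Set V) (x v : V) : Prop :=
  ∃ ε : ℝ, 0 < ε ∧ ∀ t ∈ Icc (0 : ℝ) ε, x + t • v ∈ Z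

/-! ### Piecewise smooth `E`-valued 1-forms

An `E`-valued 1-form on a polyhedron `X` is represented by the function `A` that sends a point
`x ∈ X` and a vector `v` pointing into `X` at `x` to the value of the form at `x` on `v` (the
values `A x v` for other pairs are irrelevant). For a piecewise smooth form, given on the simplices
`X_j` of a triangulation by smooth forms `α_j` which agree on common faces, `A x v = α_j(x)(v)` for
any simplex `X_j` into which `v` points at `x`: there always is one, and all of them give the same
value. Conversely `A` determines every `α_j`, because the vectors that point into `X_j` at `x` span
the tangent space of `X_j`. So two compatible families, possibly on different triangulations,
induce the same form on a common subdivision if and only if they have the same `A`. -/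

/-- The restriction of the form `A` to `Z` is a smooth form on `Z`, i.e. it extends to a smooth
form on an open neighbourhood of `Z` in the ambient space. -/
def IsSmoothFormOn (Z : Set V) (A : V → V → E) : Prop :=
  ∃ (U : Set V) (η : V → V →L[ℝ] E), IsOpen U ∧ Z ⊆ U ∧ ContDiffOn ℝ ∞ η U ∧
    ∀ x v, PointsInto Z x v → A x v = η x v

/-- `A` is a piecewise smooth `E`-valued 1-form on `X`: its restriction to each simplex of some
linear triangulation of `X` is smooth. The forms on two simplices automatically agree on a common
face, since both are given there by `A`. -/
def IsPiecewiseSmoothForm (X : Set V) (A : V → V → E) : Prop :=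
  ∃ T : Geometry.SimplicialComplex ℝ V, IsTriangulation T X ∧
    ∀ s ∈ T.faces, IsSmoothFormOn (convexHull ℝ (s : Set V)) A

/-- The one-sided directional derivative of `f` at `y` in direction `w`. -/
def dirDeriv (f : W → V) (y w : W) : V :=
  derivWithin (fun t : ℝ => f (y + t • w)) (Ici 0) 0

/-- The form `(f^* ⊗ φ)(A)`, for a piecewise linear map `f` and a linear map `φ` of the
coefficients. -/
def pullbackForm (f : W → V) (φ : E →L[ℝ] F) (A : V → V → E) : W → W → F :=
  fun y w => φ (A (f y) (dirDeriv f y w))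

/-- The interval `I¹ = [0, 1]`. -/
def unitSegment : Set ℝ := Icc 0 1

/-- `w` is a smooth point of the form `B` on `I¹`: it is an interior point of a nondegenerate
segment in `I¹` on which `B` is smooth. -/
def IsSmoothPoint (B : ℝ → ℝ → E) (w : ℝ) : Prop :=
  ∃ a b : ℝ, a < w ∧ w < b ∧ Icc a b ⊆ unitSegment ∧ IsSmoothFormOn (Icc a b) B

/-- The `k`-th binary tessellation of `I¹`. -/
def tessellation : ℕ → List (ℝ → ℝ)
  | 0 => [id]
  | k + 1 => [fun t : ℝ => t / 2, fun t : ℝ => (1 + t) / 2].flatMap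
      fun ρ => (tessellation k).map fun τ => ρ ∘ τ

/-- The flip of `I¹`, exchanging its endpoints. -/
def flipSegment (t : ℝ) : ℝ := 1 - t

/-- A string in `X`: a finite sequence of piecewise linear maps `I¹ → X`, each one starting at the
end point of its predecessor. -/
def IsString (X : Set V) (L : List (ℝ → V)) : Prop :=
  (∀ σ ∈ L, IsPLMap unitSegment X σ) ∧ L.IsChain fun σ τ => σ 1 = τ 0

/-- The inverse of a string. -/
def inverseString (L : List (ℝ → V)) : List (ℝ → V) :=
  (L.map fun σ => σ ∘ flipSegment).reverse

end Polyhedra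

/-! ### Lie groups and Riemann products -/

section LieGroups

variable {V : Type*} [NormedAddCommGroup V] [NormedSpace ℝ V]
  {E : Type*} [NormedAddCommGroup E] [NormedSpace ℝ E]
  (G : Type*) [TopologicalSpace G] [ChartedSpace E G] [Group G]
  {E' : Type*} [NormedAddCommGroup E'] [NormedSpace ℝ E']
  {H : Type*} [TopologicalSpace H] [ChartedSpace E' H] [Group H]

open Classical in
/-- The exponential map of `G`: the value at time `1` of the integral curve, starting at the unit
element, of the left invariant vector field with value `v` at the unit element. The Lie algebra
`GroupLieAlgebra 𝓘(ℝ, E) G`, i.e. the tangent space at `1`, is the model space `E`. -/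
def lieExp (v : E) : G :=
  if h : ∃ γ : ℝ → G, γ 0 = 1 ∧
      IsMIntegralCurve (I := 𝓘(ℝ, E)) γ
        (mulInvariantVectorField (I := 𝓘(ℝ, E)) (G := G) (v : GroupLieAlgebra 𝓘(ℝ, E) G))
  then h.choose 1 else 1

variable {G} (E E') in
/-- The Lie algebra map induced by a map `Φ` of Lie groups: its derivative at the unit element. -/
def lieMap (Φ : G → H) : E →L[ℝ] E' :=
  mfderiv 𝓘(ℝ, E) 𝓘(ℝ, E') Φ 1

open Classical in
/-- The basic Riemann product of a form `B` on `I¹`. At a smooth point `t` of `B` the coefficient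
of `B` with respect to the coordinate function of `I¹` is `B t 1`. -/
def basicRPSegment (B : ℝ → ℝ → E) : G :=
  if IsSmoothPoint B (1 / 2) then lieExp G (B (1 / 2) 1) else 1

/-- The basic Riemann product of `α` along `σ : I¹ → X`. -/
def basicRP (α : V → V → E) (σ : ℝ → V) : G :=
  basicRPSegment G (pullbackForm σ (ContinuousLinearMap.id ℝ E) α)

/-- The `k`-th refined Riemann product of `α` along `σ : I¹ → X`. -/
def refinedRP (k : ℕ) (α : V → V → E) (σ : ℝ → V) : G :=
  ((tessellation k).map fun ρ => basicRP G α (σ ∘ ρ)).prod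

/-- The multiplicative integral of `α` on `σ : I¹ → X`. -/
def multInt (α : V → V → E) (σ : ℝ → V) : G :=
  limUnder atTop fun k => refinedRP G k α σ

/-- The multiplicative integral of `α` on a string. -/
def multIntString (α : V → V → E) (L : List (ℝ → V)) : G :=
  (L.map fun σ => multInt G α σ).prod

end LieGroups

end

/-! Let `c` be the coefficient of `σ^*α`, set to `0` at non-smooth points. It is bounded on `(0, 1)`
and continuous off a finite set (`exists_almostEqual_comp`). Since halving the interval halves the
coefficient and `exp 0 = 1`, the `k`-th Riemann product is exactly the dyadic product of the values
`exp(2⁻ᵏ c)` at midpoints (`refinedRP_eq_dyadicProd`).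

Convergence is proved in a chart at `1` where multiplication obeys a mixed second difference bound
and `exp v = v + O(‖v‖²)` (`exists_isLogChart`). If `‖c‖ ≤ M` with `M` small, the dyadic product
differs from the dyadic Riemann sum by at most `2CM²`, uniformly in the depth (`dyadicProd_mem`).
The sums converge by dominated convergence, so late products differ by little more than `4CM²`.
Applied to the `2ᵏ` pieces of a subdivision, each with bound `2⁻ᵏM`, this gives a total error of
order `2ᵏ · (2⁻ᵏM)² = 2⁻ᵏM²`. Multiplying the pieces together costs only a factor `∏ (1 + CM/2ʲ)`,
bounded by `exp(2CM)`. Hence the products are Cauchy (`exists_norm_sub_le`). A large `M` is made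
small by finitely many halvings, the limits of the pieces being multiplied.

The argument is run for two functions `c`, `c'` that agree off a finite set. Functoriality needs
this: applying `φ` may turn a non-smooth point into a smooth one, so the coefficients `φ ∘ c` and
`c'` of the two sides can differ at finitely many points, which does not affect the limit.

The identities then hold at finite level and pass to the limit: splitting is the recursion for the
products, reversal follows from the symmetry of the midpoints and `exp(-v) = (exp v)⁻¹`, and
functoriality from `Φ ∘ exp = exp ∘ φ`. -/

noncomputable section

/-! ### Dyadic sums and products -/

section Dyadic

variable {E : Type*} [NormedAddCommGroup E] [NormedSpace ℝ E]
  {F : Type*} [NormedAddCommGroup F] [NormedSpace ℝ F]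

/-- The pullback of the `1`-form `c dt` along `t ↦ t / 2`. -/
def leftHalf (c : ℝ → E) (t : ℝ) : E := (1 / 2 : ℝ) • c (t / 2)

/-- The pullback of the `1`-form `c dt` along `t ↦ (1 + t) / 2`. -/
def rightHalf (c : ℝ → E) (t : ℝ) : E := (1 / 2 : ℝ) • c ((1 + t) / 2)

/-- The Riemann sum of `c` over the midpoints of the dyadic intervals of length `2⁻ⁿ`. -/
def dyadicSum : ℕ → (ℝ → E) → E
  | 0, c => c (1 / 2)
  | n + 1, c => dyadicSum n (leftHalf c) + dyadicSum n (rightHalf c)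

/-- The ordered product of `e (2⁻ⁿ c)` over the midpoints of the dyadic intervals of
length `2⁻ⁿ`. -/
def dyadicProd {G : Type*} [Mul G] (e : E → G) : ℕ → (ℝ → E) → G
  | 0, c => e (c (1 / 2))
  | n + 1, c => dyadicProd e n (leftHalf c) * dyadicProd e n (rightHalf c)

lemma half_mem_Ioo : (1 / 2 : ℝ) ∈ Ioo (0 : ℝ) 1 := by constructor <;> norm_num

lemma left_mem_Ioo {t : ℝ} (ht : t ∈ Ioo (0 : ℝ) 1) : t / 2 ∈ Ioo (0 : ℝ) 1 := by
  constructor <;> linarith [ht.1, ht.2]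

lemma right_mem_Ioo {t : ℝ} (ht : t ∈ Ioo (0 : ℝ) 1) : (1 + t) / 2 ∈ Ioo (0 : ℝ) 1 := by
  constructor <;> linarith [ht.1, ht.2]

lemma eqOn_leftHalf {c c' : ℝ → E} (h : EqOn c c' (Ioo 0 1)) :
    EqOn (leftHalf c) (leftHalf c') (Ioo 0 1) := fun t ht => by
  simp only [leftHalf, h (left_mem_Ioo ht)]

lemma eqOn_rightHalf {c c' : ℝ → E} (h : EqOn c c' (Ioo 0 1)) :
    EqOn (rightHalf c) (rightHalf c') (Ioo 0 1) := fun t ht => by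
  simp only [rightHalf, h (right_mem_Ioo ht)]

/-- All sample points are interior, and only there are the coefficients of reparametrized paths
compared. -/
lemma dyadicProd_congr {G : Type*} [Mul G] (e : E → G) (n : ℕ) {c c' : ℝ → E}
    (h : EqOn c c' (Ioo 0 1)) : dyadicProd e n c = dyadicProd e n c' := by
  induction n generalizing c c' with
  | zero => simp only [dyadicProd, h half_mem_Ioo]
  | succ n ih => simp only [dyadicProd, ih (eqOn_leftHalf h), ih (eqOn_rightHalf h)]

/-- A multiplicative map which intertwines `e` and `e'` along a linear map intertwines the dyadic
products. -/
lemma map_dyadicProd {G H : Type*} [Group G] [Group H] (Φ : G →* H) (φ : E →L[ℝ] F)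
    {e : E → G} {e' : F → H} (he : ∀ v, Φ (e v) = e' (φ v)) (n : ℕ) (c : ℝ → E) :
    Φ (dyadicProd e n c) = dyadicProd e' n (fun t => φ (c t)) := by
  induction n generalizing c with
  | zero => simp only [dyadicProd, he]
  | succ n ih =>
    have hl : leftHalf (fun t => φ (c t)) = fun t => φ (leftHalf c t) := by
      ext t; simp [leftHalf]
    have hr : rightHalf (fun t => φ (c t)) = fun t => φ (rightHalf c t) := by
      ext t; simp [rightHalf]
    simp only [dyadicProd, map_mul, ih, hl, hr]

/-- Reversing the direction of the interval inverts dyadic products. -/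
lemma dyadicProd_flip {G : Type*} [Group G] {e : E → G} (he : ∀ v, e (-v) = (e v)⁻¹) (n : ℕ)
    (c : ℝ → E) : dyadicProd e n (fun t => -c (1 - t)) = (dyadicProd e n c)⁻¹ := by
  induction n generalizing c with
  | zero => simp only [dyadicProd, he]; norm_num
  | succ n ih =>
    have hl : leftHalf (fun t => -c (1 - t)) = fun t => -rightHalf c (1 - t) := by
      ext t; simp only [leftHalf, rightHalf, smul_neg]; congr 3; ring
    have hr : rightHalf (fun t => -c (1 - t)) = fun t => -leftHalf c (1 - t) := by
      ext t; simp only [leftHalf, rightHalf, smul_neg]; congr 3; ring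
    simp only [dyadicProd, hl, hr, ih, mul_inv_rev]

/-- Two functions on `(0, 1)` which are bounded by `M` and, off a finite set, continuous and
equal. -/
def AlmostEqual (M : ℝ) (c c' : ℝ → E) : Prop :=
  (∀ t ∈ Ioo (0 : ℝ) 1, ‖c t‖ ≤ M ∧ ‖c' t‖ ≤ M) ∧ ∃ D : Set ℝ, D.Finite ∧
    ∀ t ∈ Ioo (0 : ℝ) 1, t ∉ D → ContinuousAt c t ∧ ContinuousAt c' t ∧ c t = c' t

lemma norm_half_smul_le {M : ℝ} {x : E} (h : ‖x‖ ≤ M) : ‖(1 / 2 : ℝ) • x‖ ≤ M / 2 := by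
  rw [norm_smul]; norm_num; linarith

lemma AlmostEqual.left {M : ℝ} {c c' : ℝ → E} (h : AlmostEqual M c c') :
    AlmostEqual (M / 2) (leftHalf c) (leftHalf c') := by
  obtain ⟨hb, D, hD, h⟩ := h
  refine ⟨fun t ht => ⟨norm_half_smul_le (hb _ (left_mem_Ioo ht)).1,
    norm_half_smul_le (hb _ (left_mem_Ioo ht)).2⟩, (fun t : ℝ => t / 2) ⁻¹' D,
    hD.preimage (fun x _ y _ hxy => by simpa using hxy), fun t ht htD => ?_⟩
  obtain ⟨h1, h2, h3⟩ := h _ (left_mem_Ioo ht) htD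
  have hc : ContinuousAt (fun t : ℝ => t / 2) t := by fun_prop
  exact ⟨(ContinuousAt.comp (f := fun t : ℝ => t / 2) h1 hc).const_smul _,
    (ContinuousAt.comp (f := fun t : ℝ => t / 2) h2 hc).const_smul _, by simp only [leftHalf, h3]⟩

lemma AlmostEqual.right {M : ℝ} {c c' : ℝ → E} (h : AlmostEqual M c c') :
    AlmostEqual (M / 2) (rightHalf c) (rightHalf c') := by
  obtain ⟨hb, D, hD, h⟩ := h
  refine ⟨fun t ht => ⟨norm_half_smul_le (hb _ (right_mem_Ioo ht)).1,
    norm_half_smul_le (hb _ (right_mem_Ioo ht)).2⟩, (fun t : ℝ => (1 + t) / 2) ⁻¹' D,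
    hD.preimage (fun x _ y _ hxy => by simpa using hxy), fun t ht htD => ?_⟩
  obtain ⟨h1, h2, h3⟩ := h _ (right_mem_Ioo ht) htD
  have hc : ContinuousAt (fun t : ℝ => (1 + t) / 2) t := by fun_prop
  exact ⟨(ContinuousAt.comp (f := fun t : ℝ => (1 + t) / 2) h1 hc).const_smul _,
    (ContinuousAt.comp (f := fun t : ℝ => (1 + t) / 2) h2 hc).const_smul _,
    by simp only [rightHalf, h3]⟩

omit [NormedSpace ℝ E] in
lemma AlmostEqual.congr {M : ℝ} {c d : ℝ → E} (h : AlmostEqual M c c)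
    (hcd : EqOn c d (Ioo 0 1)) : AlmostEqual M d d := by
  obtain ⟨hb, D, hD, h⟩ := h
  refine ⟨fun t ht => hcd ht ▸ hb t ht, D, hD, fun t ht htD => ?_⟩
  have : ContinuousAt d t := (h t ht htD).1.congr (by
    filter_upwards [Ioo_mem_nhds ht.1 ht.2] with s hs using hcd hs)
  exact ⟨this, this, rfl⟩

/-! ### Dyadic sums as integrals of step functions. -/

/-- The midpoint of the dyadic interval of length `2⁻ⁿ` that contains `t`. -/
def dyadicMid (n : ℕ) (t : ℝ) : ℝ := ((⌊2 ^ n * t⌋ : ℝ) + 1 / 2) / 2 ^ n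

lemma dyadicMid_mem (n : ℕ) {t : ℝ} (ht : t ∈ Ico (0 : ℝ) 1) : dyadicMid n t ∈ Ioo (0 : ℝ) 1 := by
  have hp : (0 : ℝ) < 2 ^ n := by positivity
  have h0 : (0 : ℝ) ≤ (⌊2 ^ n * t⌋ : ℝ) := by
    exact_mod_cast Int.floor_nonneg.2 (mul_nonneg hp.le ht.1)
  have h1 : (⌊2 ^ n * t⌋ : ℝ) + 1 ≤ 2 ^ n := by
    have : ⌊2 ^ n * t⌋ < (2 ^ n : ℤ) := by
      rw [Int.floor_lt]; push_cast; nlinarith [ht.2]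
    exact_mod_cast this
  constructor
  · unfold dyadicMid; positivity
  · unfold dyadicMid; rw [div_lt_one hp]; linarith

lemma abs_dyadicMid_sub_le (n : ℕ) (t : ℝ) : |dyadicMid n t - t| ≤ (1 / 2) ^ n := by
  have hp : (0 : ℝ) < 2 ^ n := by positivity
  have h0 := Int.floor_le (2 ^ n * t)
  have h1 := Int.lt_floor_add_one (2 ^ n * t)
  have : dyadicMid n t - t = ((⌊2 ^ n * t⌋ : ℝ) + 1 / 2 - 2 ^ n * t) / 2 ^ n := by
    unfold dyadicMid; field_simp
  rw [this, abs_div, abs_of_pos hp, div_le_iff₀ hp, ← mul_pow, abs_le]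
  norm_num
  constructor <;> linarith

lemma tendsto_dyadicMid (t : ℝ) : Tendsto (fun n => dyadicMid n t) atTop (𝓝 t) := by
  rw [tendsto_iff_norm_sub_tendsto_zero]
  exact squeeze_zero (fun _ => norm_nonneg _) (fun n => abs_dyadicMid_sub_le n t)
    (tendsto_pow_atTop_nhds_zero_of_lt_one (by norm_num) (by norm_num))

variable [CompleteSpace E]

-- The step function factors through the integer-valued floor, so nothing is required of `c`.
omit [NormedSpace ℝ E] [CompleteSpace E] in
lemma stronglyMeasurable_comp_dyadicMid (c : ℝ → E) (n : ℕ) :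
    MeasureTheory.StronglyMeasurable fun t => c (dyadicMid n t) := by
  have h1 : Measurable fun t : ℝ => ⌊2 ^ n * t⌋ := by fun_prop
  exact (MeasureTheory.StronglyMeasurable.of_discrete
    (f := fun i : ℤ => c (((i : ℝ) + 1 / 2) / 2 ^ n))).comp_measurable h1

omit [NormedSpace ℝ E] [CompleteSpace E] in
lemma intervalIntegrable_comp_dyadicMid {c : ℝ → E} {M : ℝ} (hc : ∀ t ∈ Ioo (0 : ℝ) 1, ‖c t‖ ≤ M)
    (n : ℕ) {a b : ℝ} (ha : a ∈ Icc (0 : ℝ) 1) (hb : b ∈ Icc (0 : ℝ) 1) :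
    IntervalIntegrable (fun t => c (dyadicMid n t)) MeasureTheory.volume a b := by
  have h01 : IntervalIntegrable (fun t => c (dyadicMid n t)) MeasureTheory.volume 0 1 := by
    rw [intervalIntegrable_iff_integrableOn_Ico_of_le zero_le_one]
    refine MeasureTheory.IntegrableOn.of_bound (by simp)
      (stronglyMeasurable_comp_dyadicMid c n).aestronglyMeasurable M ?_
    exact (MeasureTheory.ae_restrict_iff' measurableSet_Ico).2
      (Eventually.of_forall fun t ht => hc _ (dyadicMid_mem n ht))
  refine h01.mono_set ?_
  rw [uIcc_of_le zero_le_one]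
  exact uIcc_subset_Icc ha hb

/-- Turns convergence of the sums into dominated convergence of step functions. The induction uses
that the midpoint map of depth `n + 1` is a rescaled copy of that of depth `n` on each half of the
interval. -/
lemma dyadicSum_eq_integral {c : ℝ → E} {M : ℝ} (hc : ∀ t ∈ Ioo (0 : ℝ) 1, ‖c t‖ ≤ M) (n : ℕ) :
    dyadicSum n c = ∫ t in (0 : ℝ)..1, c (dyadicMid n t) := by
  induction n generalizing c M with
  | zero =>
    have : EqOn (fun t => c (dyadicMid 0 t)) (fun _ => c (1 / 2)) (Ioo (0 : ℝ) 1) := fun t ht => by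
      have : ⌊t⌋ = 0 := Int.floor_eq_zero_iff.2 ⟨ht.1.le, ht.2⟩
      simp [dyadicMid, this]
    rw [intervalIntegral.integral_of_le zero_le_one, MeasureTheory.integral_Ioc_eq_integral_Ioo,
      MeasureTheory.setIntegral_congr_fun measurableSet_Ioo this]
    simp [dyadicSum]
  | succ n ih =>
    have hl : ∀ t ∈ Ioo (0 : ℝ) 1, ‖leftHalf c t‖ ≤ M / 2 := fun t ht =>
      norm_half_smul_le (hc _ (left_mem_Ioo ht))
    have hr : ∀ t ∈ Ioo (0 : ℝ) 1, ‖rightHalf c t‖ ≤ M / 2 := fun t ht =>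
      norm_half_smul_le (hc _ (right_mem_Ioo ht))
    have hm : (1 / 2 : ℝ) ∈ Icc (0 : ℝ) 1 := Ioo_subset_Icc_self half_mem_Ioo
    rw [dyadicSum, ih hl, ih hr, ← intervalIntegral.integral_add_adjacent_intervals
      (intervalIntegrable_comp_dyadicMid hc (n + 1) (left_mem_Icc.2 zero_le_one) hm)
      (intervalIntegrable_comp_dyadicMid hc (n + 1) hm (right_mem_Icc.2 zero_le_one))]
    have hp : (2 : ℝ) ^ n ≠ 0 := by positivity
    congr 1
    · have := intervalIntegral.integral_comp_mul_left (a := 0) (b := 1)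
        (fun t => c (dyadicMid (n + 1) t)) (c := (1 / 2 : ℝ)) (by norm_num)
      have h2 : ∫ t in (0 : ℝ)..1, leftHalf c (dyadicMid n t) =
          (1 / 2 : ℝ) • ∫ t in (0 : ℝ)..1, c (dyadicMid (n + 1) (1 / 2 * t)) := by
        rw [← intervalIntegral.integral_smul]
        congr 1; ext t
        simp only [leftHalf, dyadicMid]
        rw [show (2 : ℝ) ^ (n + 1) * (1 / 2 * t) = 2 ^ n * t by ring]
        congr 2; field_simp; ring
      rw [h2, this, smul_smul]; norm_num
    · have := intervalIntegral.integral_comp_mul_add (a := 0) (b := 1)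
        (fun t => c (dyadicMid (n + 1) t)) (c := (1 / 2 : ℝ)) (by norm_num) (1 / 2)
      have h2 : ∫ t in (0 : ℝ)..1, rightHalf c (dyadicMid n t) =
          (1 / 2 : ℝ) • ∫ t in (0 : ℝ)..1, c (dyadicMid (n + 1) (1 / 2 * t + 1 / 2)) := by
        rw [← intervalIntegral.integral_smul]
        congr 1; ext t
        simp only [rightHalf, dyadicMid]
        -- On the right half the floor is shifted by the integer `2 ^ n`.
        rw [show (2 : ℝ) ^ (n + 1) * (1 / 2 * t + 1 / 2) = 2 ^ n * t + ((2 ^ n : ℤ) : ℝ) by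
          push_cast; ring, Int.floor_add_intCast]
        push_cast
        congr 2; field_simp; ring
      rw [h2, this, smul_smul]; norm_num

/-- The dyadic Riemann sums of almost equal functions converge to the same limit. -/
lemma AlmostEqual.exists_tendsto_dyadicSum {M : ℝ} {c c' : ℝ → E} (h : AlmostEqual M c c') :
    ∃ I, Tendsto (fun n => dyadicSum n c) atTop (𝓝 I) ∧
      Tendsto (fun n => dyadicSum n c') atTop (𝓝 I) := by
  obtain ⟨hb, D, hD, h⟩ := h
  have hae : ∀ᵐ t ∂(MeasureTheory.volume : MeasureTheory.Measure ℝ),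
      t ∈ uIoc (0 : ℝ) 1 → t ∈ Ioo (0 : ℝ) 1 ∧ t ∉ D := by
    -- The endpoint `1` is dropped because its `dyadicMid` lies beyond `1`, where `c` is not
    -- controlled.
    have hfin : (D ∪ {1}).Finite := hD.union (finite_singleton 1)
    filter_upwards [hfin.countable.ae_notMem MeasureTheory.volume] with t ht ht1
    rw [uIoc_of_le zero_le_one] at ht1
    simp only [mem_union, mem_singleton_iff, not_or] at ht
    exact ⟨⟨ht1.1, lt_of_le_of_ne ht1.2 ht.2⟩, ht.1⟩
  have key : ∀ d : ℝ → E, (∀ t ∈ Ioo (0 : ℝ) 1, ‖d t‖ ≤ M) →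
      (∀ t ∈ Ioo (0 : ℝ) 1, t ∉ D → ContinuousAt d t ∧ d t = c t) →
      Tendsto (fun n => dyadicSum n d) atTop (𝓝 (∫ t in (0 : ℝ)..1, c t)) := by
    intro d hd hdc
    simp_rw [dyadicSum_eq_integral hd]
    refine intervalIntegral.tendsto_integral_filter_of_dominated_convergence (fun _ => M)
      (Eventually.of_forall fun n => (stronglyMeasurable_comp_dyadicMid d n).aestronglyMeasurable)
      (Eventually.of_forall fun n => ?_) (by simp) ?_
    · filter_upwards [hae] with t ht ht1
      exact hd _ (dyadicMid_mem n (Ioo_subset_Ico_self (ht ht1).1))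
    · filter_upwards [hae] with t ht ht1
      obtain ⟨h1, h2⟩ := hdc t (ht ht1).1 (ht ht1).2
      rw [← h2]
      exact h1.tendsto.comp (tendsto_dyadicMid t)
  exact ⟨_, key c (fun t ht => (hb t ht).1) fun t ht htD => ⟨(h t ht htD).1, rfl⟩,
    key c' (fun t ht => (hb t ht).2) fun t ht htD => ⟨(h t ht htD).2.1, (h t ht htD).2.2.symm⟩⟩

end Dyadic

/-! ### Convergence of dyadic products in a group with a logarithmic chart -/

section LogChart

variable {E : Type*} [NormedAddCommGroup E] [NormedSpace ℝ E]
  {G : Type*} [TopologicalSpace G] [Group G]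

/-- A chart `ψ` of `G` centred at `1` in which the multiplication satisfies a second order
estimate. -/
structure IsMulChart (ψ : OpenPartialHomeomorph G E) (r C : ℝ) : Prop where
  pos : 0 < r
  const_pos : 0 < C
  one_mem : (1 : G) ∈ ψ.source
  map_one : ψ 1 = 0
  closedBall_subset : Metric.closedBall 0 r ⊆ ψ.target
  mul_mem : ∀ {g h : G}, g ∈ ψ.source → ‖ψ g‖ ≤ r → h ∈ ψ.source → ‖ψ h‖ ≤ r → g * h ∈ ψ.source
  norm_sub_le : ∀ {g g' h h' : G}, g ∈ ψ.source → ‖ψ g‖ ≤ r → g' ∈ ψ.source → ‖ψ g'‖ ≤ r →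
    h ∈ ψ.source → ‖ψ h‖ ≤ r → h' ∈ ψ.source → ‖ψ h'‖ ≤ r →
    ‖ψ (g * h) - ψ (g' * h) - (ψ (g * h') - ψ (g' * h'))‖ ≤ C * ‖ψ g - ψ g'‖ * ‖ψ h - ψ h'‖

/-- A chart `ψ` of `G` centred at `1` in which the multiplication satisfies a second order
estimate, and in which `e` agrees with the identity to first order. -/
structure IsLogChart (ψ : OpenPartialHomeomorph G E) (e : E → G) (r C : ℝ) : Prop
    extends IsMulChart ψ r C where
  exp_mem : ∀ {v : E}, ‖v‖ ≤ r → e v ∈ ψ.source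
  norm_exp_sub_le : ∀ {v : E}, ‖v‖ ≤ r → ‖ψ (e v) - v‖ ≤ C * ‖v‖ ^ 2

omit [NormedSpace ℝ E] in
lemma IsMulChart.mono {ψ : OpenPartialHomeomorph G E} {r C r' C' : ℝ} (hψ : IsMulChart ψ r C)
    (hr' : 0 < r') (hr : r' ≤ r) (hC : C ≤ C') : IsMulChart ψ r' C' where
  pos := hr'
  const_pos := hψ.const_pos.trans_le hC
  one_mem := hψ.one_mem
  map_one := hψ.map_one
  closedBall_subset := (Metric.closedBall_subset_closedBall hr).trans hψ.closedBall_subset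
  mul_mem h1 h2 h3 h4 := hψ.mul_mem h1 (h2.trans hr) h3 (h4.trans hr)
  norm_sub_le h1 h2 h3 h4 h5 h6 h7 h8 :=
    (hψ.norm_sub_le h1 (h2.trans hr) h3 (h4.trans hr) h5 (h6.trans hr) h7 (h8.trans hr)).trans
      (by gcongr)

namespace IsLogChart

variable {ψ : OpenPartialHomeomorph G E} {e : E → G} {r C : ℝ} (hψ : IsLogChart ψ e r C)
include hψ

-- The second difference bound with `g' = h' = 1`: multiplication is addition up to a product of
-- norms.
omit [NormedSpace ℝ E] in
lemma norm_mul_sub_le {g h : G} (hg : g ∈ ψ.source) (hgr : ‖ψ g‖ ≤ r) (hh : h ∈ ψ.source)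
    (hhr : ‖ψ h‖ ≤ r) : ‖ψ (g * h) - (ψ g + ψ h)‖ ≤ C * ‖ψ g‖ * ‖ψ h‖ := by
  have h1 : ‖ψ 1‖ ≤ r := by rw [hψ.map_one, norm_zero]; exact hψ.pos.le
  have := hψ.norm_sub_le hg hgr hψ.one_mem h1 hh hhr hψ.one_mem h1
  simp only [one_mul, mul_one, hψ.map_one, sub_zero] at this
  convert this using 2; abel

-- Change one factor at a time, comparing each change with the same change next to `1`. The form `1
-- + C * s` of the Lipschitz constant matters: as `s` halves with each generation, the product of
-- these constants stays bounded.
omit [NormedSpace ℝ E] in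
lemma norm_mul_sub_mul_le {g g' h h' : G} {s : ℝ} (hs : s ≤ r)
    (hg : g ∈ ψ.source) (hgr : ‖ψ g‖ ≤ s) (hg' : g' ∈ ψ.source) (hgr' : ‖ψ g'‖ ≤ s)
    (hh : h ∈ ψ.source) (hhr : ‖ψ h‖ ≤ s) (hh' : h' ∈ ψ.source) (hhr' : ‖ψ h'‖ ≤ s) :
    ‖ψ (g * h) - ψ (g' * h')‖ ≤ (1 + C * s) * (‖ψ g - ψ g'‖ + ‖ψ h - ψ h'‖) := by
  have h1 : ‖ψ 1‖ ≤ r := by rw [hψ.map_one, norm_zero]; exact hψ.pos.le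
  have hC := hψ.const_pos
  have e1 := hψ.norm_sub_le hg (hgr.trans hs) hg' (hgr'.trans hs) hh (hhr.trans hs) hψ.one_mem h1
  have e2 := hψ.norm_sub_le hg' (hgr'.trans hs) hψ.one_mem h1 hh (hhr.trans hs) hh' (hhr'.trans hs)
  simp only [one_mul, mul_one, hψ.map_one, sub_zero] at e1 e2
  have e1' : C * ‖ψ g - ψ g'‖ * ‖ψ h‖ ≤ C * s * ‖ψ g - ψ g'‖ := by
    nlinarith [mul_le_mul_of_nonneg_left hhr (mul_nonneg hC.le (norm_nonneg (ψ g - ψ g')))]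
  have e2' : C * ‖ψ g'‖ * ‖ψ h - ψ h'‖ ≤ C * s * ‖ψ h - ψ h'‖ := by
    gcongr
  have hsplit : ψ (g * h) - ψ (g' * h') =
      (ψ (g * h) - ψ (g' * h) - (ψ g - ψ g')) + (ψ g - ψ g') +
      ((ψ (g' * h) - ψ h - (ψ (g' * h') - ψ h')) + (ψ h - ψ h')) := by abel
  rw [hsplit]
  refine (norm_add_le _ _).trans ?_
  have a1 := norm_add_le (ψ (g * h) - ψ (g' * h) - (ψ g - ψ g')) (ψ g - ψ g')
  have a2 := norm_add_le (ψ (g' * h) - ψ h - (ψ (g' * h') - ψ h')) (ψ h - ψ h')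
  linarith

/-- In a logarithmic chart, dyadic products agree with dyadic sums up to second order. -/
lemma dyadicProd_mem {M : ℝ} (hMr : 2 * M ≤ r) (hMC : 2 * C * M ≤ 1) (n : ℕ) {c : ℝ → E}
    (hc : ∀ t ∈ Ioo (0 : ℝ) 1, ‖c t‖ ≤ M) :
    dyadicProd e n c ∈ ψ.source ∧ ‖ψ (dyadicProd e n c) - dyadicSum n c‖ ≤ 2 * C * M ^ 2 ∧
      ‖dyadicSum n c‖ ≤ M ∧ ‖ψ (dyadicProd e n c)‖ ≤ 2 * M := by
  have hC := hψ.const_pos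
  have h0 : 0 ≤ M := (norm_nonneg _).trans (hc _ half_mem_Ioo)
  suffices h : dyadicProd e n c ∈ ψ.source ∧
      ‖ψ (dyadicProd e n c) - dyadicSum n c‖ ≤ 2 * C * M ^ 2 ∧ ‖dyadicSum n c‖ ≤ M by
    refine ⟨h.1, h.2.1, h.2.2, ?_⟩
    have := norm_add_le (ψ (dyadicProd e n c) - dyadicSum n c) (dyadicSum n c)
    rw [sub_add_cancel] at this
    nlinarith [h.2.1, h.2.2]
  induction n generalizing c M with
  | zero =>
    have hb := hc _ half_mem_Ioo
    refine ⟨hψ.exp_mem (by linarith), (hψ.norm_exp_sub_le (by linarith)).trans ?_, hb⟩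
    have : C * ‖c (1 / 2)‖ ^ 2 ≤ C * M ^ 2 := by gcongr
    nlinarith [mul_nonneg hC.le (sq_nonneg M)]
  | succ n ih =>
    have hM2 : 2 * (M / 2) ≤ r := by linarith
    have hMC2 : 2 * C * (M / 2) ≤ 1 := by nlinarith
    have h02 : 0 ≤ M / 2 := by linarith
    obtain ⟨l1, l2, l3⟩ := ih (M := M / 2) (c := leftHalf c) hM2 hMC2
      (fun t ht => norm_half_smul_le (hc _ (left_mem_Ioo ht))) h02
    obtain ⟨r1, r2, r3⟩ := ih (M := M / 2) (c := rightHalf c) hM2 hMC2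
      (fun t ht => norm_half_smul_le (hc _ (right_mem_Ioo ht))) h02
    simp only [dyadicProd, dyadicSum]
    set g := dyadicProd e n (leftHalf c)
    set h := dyadicProd e n (rightHalf c)
    set x := dyadicSum n (leftHalf c)
    set y := dyadicSum n (rightHalf c)
    have hCM : 2 * C * (M / 2) ^ 2 ≤ M / 2 := by nlinarith
    have hg : ‖ψ g‖ ≤ M := by
      have := norm_add_le (ψ g - x) x
      rw [sub_add_cancel] at this; linarith
    have hh : ‖ψ h‖ ≤ M := by
      have := norm_add_le (ψ h - y) y
      rw [sub_add_cancel] at this; linarith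
    have hMr' : M ≤ r := by linarith
    refine ⟨hψ.mul_mem l1 (hg.trans hMr') r1 (hh.trans hMr'), ?_, ?_⟩
    · have e1 := hψ.norm_mul_sub_le l1 (hg.trans hMr') r1 (hh.trans hMr')
      -- The constant reproduces itself: the new error `C * M ^ 2` plus two inherited errors `2 * C
      -- * (M / 2) ^ 2` make `2 * C * M ^ 2`.
      have e2 : C * ‖ψ g‖ * ‖ψ h‖ ≤ C * M * M := by gcongr
      have hsplit : ψ (g * h) - (x + y) =
        (ψ (g * h) - (ψ g + ψ h)) + ((ψ g - x) + (ψ h - y)) := by abel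
      rw [hsplit]
      have a1 := norm_add_le (ψ (g * h) - (ψ g + ψ h)) ((ψ g - x) + (ψ h - y))
      have a2 := norm_add_le (ψ g - x) (ψ h - y)
      nlinarith
    · linarith [norm_add_le x y]

/-- The key estimate: subdividing `k` times, dyadic products of almost equal functions differ, in
the limit, by `O(2⁻ᵏ)`. -/
lemma exists_norm_sub_le [CompleteSpace E] {M : ℝ} (hMr : 2 * M ≤ r) (hMC : 2 * C * M ≤ 1) (k : ℕ)
    {c c' : ℝ → E} (h : AlmostEqual M c c') {ε : ℝ} (hε : 0 < ε) :
    ∃ N, ∀ n m, N ≤ n → N ≤ m → ‖ψ (dyadicProd e n c) - ψ (dyadicProd e m c')‖ ≤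
      4 * C * M ^ 2 * (1 / 2) ^ k * Real.exp (2 * C * M) + ε := by
  have hC := hψ.const_pos
  have h0 : 0 ≤ M := (norm_nonneg _).trans (h.1 _ half_mem_Ioo).1
  induction k generalizing M c c' ε with
  | zero =>
    obtain ⟨I, h1, h2⟩ := h.exists_tendsto_dyadicSum
    obtain ⟨N₁, hN₁⟩ := Metric.tendsto_atTop.1 h1 (ε / 2) (half_pos hε)
    obtain ⟨N₂, hN₂⟩ := Metric.tendsto_atTop.1 h2 (ε / 2) (half_pos hε)
    refine ⟨max N₁ N₂, fun n m hn hm => ?_⟩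
    have d1 := hN₁ n (le_of_max_le_left hn)
    have d2 := hN₂ m (le_of_max_le_right hm)
    rw [dist_eq_norm] at d1 d2
    have a1 := (hψ.dyadicProd_mem hMr hMC n fun t ht => (h.1 t ht).1).2.1
    have a2 := (hψ.dyadicProd_mem hMr hMC m fun t ht => (h.1 t ht).2).2.1
    have hexp : 1 ≤ Real.exp (2 * C * M) := Real.one_le_exp (by positivity)
    -- Each product is within `2 * C * M ^ 2` of its sum, and both sums are near the same `I`.
    have hle : 4 * C * M ^ 2 ≤ 4 * C * M ^ 2 * (1 / 2) ^ 0 * Real.exp (2 * C * M) := by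
      rw [pow_zero, mul_one]; exact le_mul_of_one_le_right (by positivity) hexp
    refine le_trans ?_ (add_le_add_left hle ε)
    set p := ψ (dyadicProd e n c)
    set q := ψ (dyadicProd e m c')
    have hsplit : p - q = ((p - dyadicSum n c) - (q - dyadicSum m c')) +
      ((dyadicSum n c - I) - (dyadicSum m c' - I)) := by abel
    rw [hsplit]
    have b1 := norm_add_le ((p - dyadicSum n c) - (q - dyadicSum m c'))
      ((dyadicSum n c - I) - (dyadicSum m c' - I))
    have b2 := _root_.norm_sub_le (p - dyadicSum n c) (q - dyadicSum m c')
    have b3 := _root_.norm_sub_le (dyadicSum n c - I) (dyadicSum m c' - I)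
    linarith
  | succ k ih =>
    have hM2 : 2 * (M / 2) ≤ r := by linarith
    have hMC2 : 2 * C * (M / 2) ≤ 1 := by nlinarith
    have h02 : 0 ≤ M / 2 := by linarith
    obtain ⟨N₁, hN₁⟩ := ih hM2 hMC2 h.left (ε := ε / 4) (by linarith) h02
    obtain ⟨N₂, hN₂⟩ := ih hM2 hMC2 h.right (ε := ε / 4) (by linarith) h02
    -- The shift by one makes both depths successors, so that both products split into halves.
    refine ⟨max N₁ N₂ + 1, fun n m hn hm => ?_⟩
    obtain ⟨n, rfl⟩ := Nat.exists_eq_add_of_le' (le_of_add_le_right hn)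
    obtain ⟨m, rfl⟩ := Nat.exists_eq_add_of_le' (le_of_add_le_right hm)
    have hn' := Nat.le_of_add_le_add_right hn
    have hm' := Nat.le_of_add_le_add_right hm
    have d1 := hN₁ n m (le_of_max_le_left hn') (le_of_max_le_left hm')
    have d2 := hN₂ n m (le_of_max_le_right hn') (le_of_max_le_right hm')
    obtain ⟨l1, -, -, l2⟩ := hψ.dyadicProd_mem hM2 hMC2 n fun t ht => (h.left.1 t ht).1
    obtain ⟨l1', -, -, l2'⟩ := hψ.dyadicProd_mem hM2 hMC2 m fun t ht => (h.left.1 t ht).2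
    obtain ⟨r1, -, -, r2⟩ := hψ.dyadicProd_mem hM2 hMC2 n fun t ht => (h.right.1 t ht).1
    obtain ⟨r1', -, -, r2'⟩ := hψ.dyadicProd_mem hM2 hMC2 m fun t ht => (h.right.1 t ht).2
    have key := hψ.norm_mul_sub_mul_le hM2 l1 l2 l1' l2' r1 r2 r1' r2'
    simp only [dyadicProd]
    refine key.trans ?_
    have hCM : 0 ≤ C * M := by positivity
    have hexp : 1 + C * M ≤ Real.exp (C * M) := by linarith [Real.add_one_le_exp (C * M)]
    have hee : Real.exp (2 * C * M) = Real.exp (C * M) * Real.exp (C * M) := by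
      rw [← Real.exp_add]; ring_nf
    rw [show 2 * C * (M / 2) = C * M by ring] at d1 d2
    rw [hee, show C * (2 * (M / 2)) = C * M by ring]
    set X := Real.exp (C * M)
    set B := 4 * C * (M / 2) ^ 2 * (1 / 2) ^ k * X with hB
    have hB0 : 0 ≤ B := by positivity
    -- Halving `M` divides `M ^ 2` by four while there are two halves; the net factor `1 / 2` is the
    -- gain. The factor `1 + C * M` is absorbed by the exponential in the main term, and bounded by
    -- `2` in front of `ε`.
    calc _ ≤ (1 + C * M) * ((B + ε / 4) + (B + ε / 4)) := by gcongr
      _ = (1 + C * M) * (2 * B) + (1 + C * M) * (ε / 2) := by ring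
      _ ≤ X * (2 * B) + 2 * (ε / 2) := by gcongr; nlinarith
      _ = _ := by rw [hB]; ring

/-- Dyadic products of almost equal functions converge to the same limit, if the functions are
small. -/
lemma exists_tendsto_of_small [CompleteSpace E] {M : ℝ} (hMr : 2 * M ≤ r) (hMC : 2 * C * M ≤ 1)
    {c c' : ℝ → E} (h : AlmostEqual M c c') :
    ∃ g, Tendsto (fun n => dyadicProd e n c) atTop (𝓝 g) ∧
      Tendsto (fun n => dyadicProd e n c') atTop (𝓝 g) := by
  have key : ∀ ε > 0, ∃ N, ∀ n m, N ≤ n → N ≤ m →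
      ‖ψ (dyadicProd e n c) - ψ (dyadicProd e m c')‖ ≤ ε := by
    intro ε hε
    have ht : Tendsto (fun k : ℕ => 4 * C * M ^ 2 * (1 / 2) ^ k * Real.exp (2 * C * M)) atTop
        (𝓝 (4 * C * M ^ 2 * 0 * Real.exp (2 * C * M))) :=
      ((tendsto_pow_atTop_nhds_zero_of_lt_one (by norm_num) (by norm_num)).const_mul _).mul_const _
    rw [mul_zero, zero_mul] at ht
    obtain ⟨k, hk⟩ := (ht.eventually (gt_mem_nhds (half_pos hε))).exists
    obtain ⟨N, hN⟩ := hψ.exists_norm_sub_le hMr hMC k h (half_pos hε)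
    exact ⟨N, fun n m hn hm => (hN n m hn hm).trans (by linarith)⟩
  have hcau : CauchySeq fun n => ψ (dyadicProd e n c) := by
    refine Metric.cauchySeq_iff.2 fun ε hε => ?_
    obtain ⟨N, hN⟩ := key (ε / 3) (by linarith)
    refine ⟨N, fun m hm n hn => ?_⟩
    have a1 := hN m N hm le_rfl
    have a2 := hN n N hn le_rfl
    rw [← dist_eq_norm] at a1 a2
    linarith [dist_triangle_right (ψ (dyadicProd e m c)) (ψ (dyadicProd e n c))
      (ψ (dyadicProd e N c'))]
  obtain ⟨x, hx⟩ := cauchySeq_tendsto_of_complete hcau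
  have hx' : Tendsto (fun n => ψ (dyadicProd e n c')) atTop (𝓝 x) := by
    refine hx.congr_dist (Metric.tendsto_atTop.2 fun ε hε => ?_)
    obtain ⟨N, hN⟩ := key (ε / 2) (by linarith)
    refine ⟨N, fun n hn => ?_⟩
    have := hN n n hn hn
    rw [Real.dist_eq, sub_zero, abs_of_nonneg dist_nonneg, dist_eq_norm]
    linarith
  -- The limit in `E` must lie in the chart's image to give a limit in `G`; a closed ball inside the
  -- target ensures it.
  have hmem : x ∈ ψ.target := by
    refine hψ.closedBall_subset (Metric.isClosed_closedBall.mem_of_tendsto hx ?_)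
    refine Eventually.of_forall fun n => ?_
    rw [mem_closedBall_zero_iff]
    exact (hψ.dyadicProd_mem hMr hMC n fun t ht => (h.1 t ht).1).2.2.2.trans hMr
  have hcont := ψ.continuousAt_symm hmem
  refine ⟨ψ.symm x, (hcont.tendsto.comp hx).congr fun n => ?_,
    (hcont.tendsto.comp hx').congr fun n => ?_⟩
  · exact ψ.left_inv (hψ.dyadicProd_mem hMr hMC n fun t ht => (h.1 t ht).1).1
  · exact ψ.left_inv (hψ.dyadicProd_mem hMr hMC n fun t ht => (h.1 t ht).2).1

/-- Dyadic products of almost equal functions converge to the same limit. -/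
theorem exists_tendsto_dyadicProd [CompleteSpace E] [ContinuousMul G] {M : ℝ}
    {c c' : ℝ → E} (h : AlmostEqual M c c') :
    ∃ g, Tendsto (fun n => dyadicProd e n c) atTop (𝓝 g) ∧
      Tendsto (fun n => dyadicProd e n c') atTop (𝓝 g) := by
  have main : ∀ k : ℕ, ∀ M : ℝ, ∀ c c' : ℝ → E, AlmostEqual M c c' →
      2 * M * (1 / 2) ^ k ≤ r → 2 * C * M * (1 / 2) ^ k ≤ 1 →
      ∃ g, Tendsto (fun n => dyadicProd e n c) atTop (𝓝 g) ∧
        Tendsto (fun n => dyadicProd e n c') atTop (𝓝 g) := by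
    intro k
    induction k with
    | zero =>
      intro M c c' h h1 h2
      exact hψ.exists_tendsto_of_small (by simpa using h1) (by simpa using h2) h
    | succ k ih =>
      intro M c c' h h1 h2
      rw [pow_succ] at h1 h2
      obtain ⟨g, l1, l2⟩ := ih _ _ _ h.left (by linarith) (by linarith)
      obtain ⟨g', r1, r2⟩ := ih _ _ _ h.right (by linarith) (by linarith)
      exact ⟨g * g', (tendsto_add_atTop_iff_nat 1).1 (l1.mul r1),
        (tendsto_add_atTop_iff_nat 1).1 (l2.mul r2)⟩
  have hp : Tendsto (fun k : ℕ => ((1 : ℝ) / 2) ^ k) atTop (𝓝 0) :=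
    tendsto_pow_atTop_nhds_zero_of_lt_one (by norm_num) (by norm_num)
  have t1 := hp.const_mul (2 * M)
  have t2 := hp.const_mul (2 * C * M)
  rw [mul_zero] at t1 t2
  obtain ⟨k, hk1, hk2⟩ :=
    ((t1.eventually (gt_mem_nhds hψ.pos)).and (t2.eventually (gt_mem_nhds one_pos))).exists
  exact main k M c c' h hk1.le hk2.le

end IsLogChart

end LogChart

/-! ### Pullbacks of piecewise smooth forms along piecewise affine paths -/

section Pullback

variable {V : Type*} [NormedAddCommGroup V] [NormedSpace ℝ V]
  {W : Type*} [NormedAddCommGroup W] [NormedSpace ℝ W]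
  {E : Type*} [NormedAddCommGroup E] [NormedSpace ℝ E]
  {F : Type*} [NormedAddCommGroup F] [NormedSpace ℝ F]

lemma PointsInto.mem {Z : Set V} {x v : V} (h : PointsInto Z x v) : x ∈ Z := by
  obtain ⟨ε, hε, h⟩ := h
  simpa using h 0 ⟨le_rfl, hε.le⟩

lemma PointsInto.mono {Z Z' : Set V} (hZ : Z ⊆ Z') {x v : V} (h : PointsInto Z x v) :
    PointsInto Z' x v := by
  obtain ⟨ε, hε, h⟩ := h
  exact ⟨ε, hε, fun t ht => hZ (h t ht)⟩

lemma PointsInto.eventually {Z : Set V} {x v : V} (h : PointsInto Z x v) :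
    ∀ᶠ t in 𝓝[≥] (0 : ℝ), x + t • v ∈ Z := by
  obtain ⟨ε, hε, h⟩ := h
  filter_upwards [Icc_mem_nhdsGE hε] with t ht using h t ht

lemma pointsInto_of_mem_Ioo {a b t : ℝ} (ht : t ∈ Ioo a b) (w : ℝ) :
    PointsInto (Icc a b) t w := by
  have hc : Continuous fun s : ℝ => t + s • w := by fun_prop
  have : (fun s : ℝ => t + s • w) ⁻¹' Icc a b ∈ 𝓝 0 :=
    hc.continuousAt.preimage_mem_nhds (by simpa using Icc_mem_nhds ht.1 ht.2)
  obtain ⟨ε, hε, h⟩ := Metric.nhds_basis_closedBall.mem_iff.1 this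
  refine ⟨ε, hε, fun s hs => h ?_⟩
  rw [Metric.mem_closedBall, dist_zero_right, Real.norm_eq_abs, abs_of_nonneg hs.1]
  exact hs.2

lemma IsSmoothFormOn.mono {Z Z' : Set V} {A : V → V → E} (h : IsSmoothFormOn Z A) (hZ : Z' ⊆ Z) :
    IsSmoothFormOn Z' A := by
  obtain ⟨U, η, hU, hZU, hη, h⟩ := h
  exact ⟨U, η, hU, hZ.trans hZU, hη, fun x v hxv => h x v (hxv.mono hZ)⟩

lemma IsSmoothFormOn.congr {Z : Set V} {A B : V → V → E} (h : IsSmoothFormOn Z A)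
    (hAB : ∀ x v, PointsInto Z x v → B x v = A x v) : IsSmoothFormOn Z B := by
  obtain ⟨U, η, hU, hZU, hη, h⟩ := h
  exact ⟨U, η, hU, hZU, hη, fun x v hxv => (hAB x v hxv).trans (h x v hxv)⟩

/-- Smooth forms pull back to smooth forms along affine maps, and are mapped to smooth forms by
linear maps of the coefficients. -/
lemma IsSmoothFormOn.comp_affine {Z : Set V} {A : V → V → E} (h : IsSmoothFormOn Z A)
    [FiniteDimensional ℝ W] (g : W →ᵃ[ℝ] V) (φ : E →L[ℝ] F) {Z' : Set W} (hg : MapsTo g Z' Z) :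
    IsSmoothFormOn Z' fun y w => φ (A (g y) (g.linear w)) := by
  obtain ⟨U, η, hU, hZU, hη, h⟩ := h
  have hgc : ContDiff ℝ ∞ g := (ContinuousAffineMap.mk g g.continuous_of_finiteDimensional).contDiff
  refine ⟨g ⁻¹' U, fun y => (φ.comp (η (g y))).comp (LinearMap.toContinuousLinearMap g.linear),
    hU.preimage hgc.continuous, fun y hy => hZU (hg hy), ?_, fun y w hyw => ?_⟩
  · exact (contDiffOn_const.clm_comp (hη.comp hgc.contDiffOn fun y hy => hy)).clm_comp
      contDiffOn_const
  · obtain ⟨ε, hε, hyw⟩ := hyw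
    have : PointsInto Z (g y) (g.linear w) := ⟨ε, hε, fun t ht => by
      have := hg (hyw t ht)
      rwa [add_comm, ← vadd_eq_add, AffineMap.map_vadd, map_smul, vadd_eq_add, add_comm] at this⟩
    simp [h _ _ this]

/-- Along a direction in which `σ` is affine, `dirDeriv` obeys the chain rule. -/
lemma dirDeriv_comp_of_affine {g : ℝ →ᵃ[ℝ] W} {σ : ℝ → W} {K : Set ℝ} (hσ : EqOn σ g K)
    (f : W → V) {t w : ℝ} (h : PointsInto K t w) :
    dirDeriv (f ∘ σ) t w = dirDeriv f (σ t) (g.linear w) := by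
  unfold dirDeriv
  have : (fun s : ℝ => (f ∘ σ) (t + s • w)) =ᶠ[𝓝[≥] 0] fun s => f (σ t + s • g.linear w) := by
    filter_upwards [h.eventually] with s hs
    rw [Function.comp_apply, hσ hs, hσ h.mem, add_comm t, ← vadd_eq_add, AffineMap.map_vadd,
      map_smul, vadd_eq_add, add_comm]
  exact this.derivWithin_eq (this.self_of_nhdsWithin self_mem_Ici)

lemma dirDeriv_id (x v : V) : dirDeriv id x v = v := by
  unfold dirDeriv
  have : HasDerivAt (fun t : ℝ => x + t • v) v 0 := by
    simpa using ((hasDerivAt_id (0 : ℝ)).smul_const v).const_add x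
  exact this.hasDerivWithinAt.derivWithin (uniqueDiffOn_Ici 0 0 self_mem_Ici)

lemma dirDeriv_of_affine {g : ℝ →ᵃ[ℝ] V} {σ : ℝ → V} {K : Set ℝ} (hσ : EqOn σ g K)
    {t w : ℝ} (h : PointsInto K t w) : dirDeriv σ t w = g.linear w := by
  have := dirDeriv_comp_of_affine hσ id h
  rwa [Function.id_comp, dirDeriv_id] at this

/-- A finite family of closed convex sets that covers `[0, 1]`, on each of which `σ` is affine and
has the property `P`. -/
def IsPiecewise (σ : ℝ → V) (P : Set ℝ → Prop) : Prop :=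
  ∃ 𝒦 : Set (Set ℝ), 𝒦.Finite ∧ Icc 0 1 ⊆ ⋃₀ 𝒦 ∧ ∀ K ∈ 𝒦, IsClosed K ∧ Convex ℝ K ∧
    K ⊆ Icc 0 1 ∧ (∃ g : ℝ →ᵃ[ℝ] V, EqOn σ g K) ∧ P K

lemma IsPiecewise.refine {σ : ℝ → V} {P Q : Set ℝ → Prop} (h : IsPiecewise σ P)
    {τ : ℝ → W} (hτ : ∀ K, P K → ∃ g : ℝ →ᵃ[ℝ] W, EqOn τ g K)
    (hPQ : ∀ K K', K' ⊆ K → P K → Q K')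
    {X : Set W} {T : Geometry.SimplicialComplex ℝ W} (hT : IsTriangulation T X)
    (hmaps : MapsTo τ (Icc 0 1) X) :
    IsPiecewise σ fun K => Q K ∧ ∃ s ∈ T.faces, MapsTo τ K (convexHull ℝ (s : Set W)) := by
  obtain ⟨𝒦, hfin, hcov, h𝒦⟩ := h
  refine ⟨Set.image2 (fun K (s : Finset W) => K ∩ τ ⁻¹' (convexHull ℝ (s : Set W))) 𝒦 T.faces,
    hfin.image2 _ hT.1, fun t ht => ?_, ?_⟩
  · obtain ⟨K, hK, htK⟩ := hcov ht
    have h2 := hmaps ht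
    rw [← hT.2, Geometry.SimplicialComplex.mem_space_iff] at h2
    obtain ⟨s, hs, hts⟩ := h2
    exact ⟨_, ⟨K, hK, s, hs, rfl⟩, htK, hts⟩
  · rintro _ ⟨K, hK, s, hs, rfl⟩
    obtain ⟨h1, h2, h3, ⟨g, hg⟩, hP⟩ := h𝒦 K hK
    obtain ⟨g', hg'⟩ := hτ K hP
    -- On `K` the path is affine, so the preimage of a simplex is again closed and convex; no
    -- triangulation of the interval has to be built.
    have heq : K ∩ τ ⁻¹' (convexHull ℝ (s : Set W)) = K ∩ g' ⁻¹' (convexHull ℝ (s : Set W)) := by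
      ext t
      simp only [mem_inter_iff, mem_preimage, and_congr_right_iff]
      intro ht
      rw [hg' ht]
    refine ⟨?_, ?_, inter_subset_left.trans h3, ⟨g, hg.mono inter_subset_left⟩,
      hPQ K _ inter_subset_left hP, s, hs, fun t ht => ht.2⟩
    · simp only [heq]
      exact h1.inter (((s.finite_toSet.isCompact_convexHull (𝕜 := ℝ)).isClosed).preimage
        g'.continuous_of_finiteDimensional)
    · simp only [heq]
      exact h2.inter ((convex_convexHull ℝ _).affine_preimage g')

lemma IsPLMap.isPiecewise {X : Set V} {σ : ℝ → V} (h : IsPLMap unitSegment X σ) :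
    IsPiecewise σ fun _ => True := by
  obtain ⟨-, T, hT, h⟩ := h
  refine ⟨(fun s : Finset ℝ => convexHull ℝ (s : Set ℝ)) '' T.faces, hT.1.image _, ?_, ?_⟩
  · have := hT.2
    rw [Geometry.SimplicialComplex.space] at this
    rw [sUnion_image, this, unitSegment]
  · rintro _ ⟨s, hs, rfl⟩
    exact ⟨(s.finite_toSet.isCompact_convexHull (𝕜 := ℝ)).isClosed, convex_convexHull ℝ _,
      (T.convexHull_subset_space hs).trans_eq hT.2, h s hs, trivial⟩

/-- The closed intervals of a piecewise decomposition: all but finitely many points of `[0, 1]` are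
interior to one of them. -/
lemma IsPiecewise.exists_intervals {σ : ℝ → V} {P : Set ℝ → Prop} (h : IsPiecewise σ P) :
    ∃ S : Set (ℝ × ℝ), S.Finite ∧ (∀ p ∈ S, Icc p.1 p.2 ⊆ Icc 0 1 ∧
      (∃ g : ℝ →ᵃ[ℝ] V, EqOn σ g (Icc p.1 p.2)) ∧ P (Icc p.1 p.2)) ∧
      ∃ D : Set ℝ, D.Finite ∧ ∀ t ∈ Icc (0 : ℝ) 1, t ∉ D → ∃ p ∈ S, t ∈ Ioo p.1 p.2 := by
  obtain ⟨𝒦, hfin, hcov, h𝒦⟩ := h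
  have hIcc : ∀ K ∈ 𝒦, K.Nonempty → K = Icc (sInf K) (sSup K) := by
    intro K hK hne
    obtain ⟨h1, h2, h3, -⟩ := h𝒦 K hK
    exact eq_Icc_of_connected_compact ⟨hne, h2.isPreconnected⟩ (isCompact_Icc.of_isClosed_subset h1 h3)
  refine ⟨(fun K => (sInf K, sSup K)) '' {K ∈ 𝒦 | K.Nonempty}, (hfin.sep _).image _, ?_,
    sInf '' 𝒦 ∪ sSup '' 𝒦, (hfin.image _).union (hfin.image _), fun t ht htD => ?_⟩
  · rintro _ ⟨K, ⟨hK, hne⟩, rfl⟩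
    obtain ⟨h1, h2, h3⟩ := h𝒦 K hK
    simp only [← hIcc K hK hne]
    exact h3
  · obtain ⟨K, hK, htK⟩ := hcov ht
    have htK' := htK
    rw [hIcc K hK ⟨t, htK⟩] at htK'
    simp only [mem_union, mem_image, not_or, not_exists, not_and] at htD
    exact ⟨_, ⟨K, ⟨hK, t, htK⟩, rfl⟩, lt_of_le_of_ne htK'.1 (htD.1 K hK),
      lt_of_le_of_ne htK'.2 fun h => htD.2 K hK h.symm⟩

open Classical in
/-- The coefficient of a form on `I¹` at its smooth points, and `0` at all other points. -/
def smoothCoeff (B : ℝ → ℝ → E) (t : ℝ) : E := if IsSmoothPoint B t then B t 1 else 0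

lemma isSmoothPoint_of_mem_Ioo {B : ℝ → ℝ → E} {a b t : ℝ} (hI : Icc a b ⊆ Icc 0 1)
    (h : IsSmoothFormOn (Icc a b) B) (ht : t ∈ Ioo a b) : IsSmoothPoint B t :=
  ⟨a, b, ht.1, ht.2, hI, h⟩

/-- Two forms on `I¹`, the first of which is smooth, and mapped to the second by `φ`, on finitely
many intervals which cover all but finitely many points, have almost equal coefficients. -/
lemma exists_almostEqual {B : ℝ → ℝ → E} {B' : ℝ → ℝ → F} (φ : E →L[ℝ] F) {S : Set (ℝ × ℝ)}
    (hS : S.Finite)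
    (h : ∀ p ∈ S, Icc p.1 p.2 ⊆ Icc 0 1 ∧ IsSmoothFormOn (Icc p.1 p.2) B ∧
      ∀ t w, PointsInto (Icc p.1 p.2) t w → B' t w = φ (B t w))
    {D : Set ℝ} (hD : D.Finite) (hcov : ∀ t ∈ Icc (0 : ℝ) 1, t ∉ D → ∃ p ∈ S, t ∈ Ioo p.1 p.2) :
    ∃ M, AlmostEqual M (fun t => φ (smoothCoeff B t)) (smoothCoeff B') := by
  have hloc : ∀ p ∈ S, ∃ η : ℝ → F, ContinuousOn η (Icc p.1 p.2) ∧
      ∀ t ∈ Ioo p.1 p.2, φ (smoothCoeff B t) = η t ∧ smoothCoeff B' t = η t := by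
    intro p hp
    obtain ⟨hI, hB, hBB'⟩ := h p hp
    have hB' : IsSmoothFormOn (Icc p.1 p.2) B' :=
      (hB.comp_affine (AffineMap.id ℝ ℝ) φ (mapsTo_id _)).congr hBB'
    obtain ⟨U, η, hU, hZU, hη, hBη⟩ := id hB
    refine ⟨fun t => φ (η t 1),
      φ.continuous.comp_continuousOn ((hη.continuousOn.mono hZU).clm_apply continuousOn_const),
      fun t ht => ?_⟩
    have hp1 := pointsInto_of_mem_Ioo ht 1
    have h1 := isSmoothPoint_of_mem_Ioo hI hB ht
    have h2 := isSmoothPoint_of_mem_Ioo hI hB' ht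
    simp only [smoothCoeff, h1, h2, if_true, hBB' t 1 hp1, hBη t 1 hp1, and_self]
  have hbdd : ∀ p ∈ S, ∃ M, ∀ t ∈ Ioo p.1 p.2,
      ‖φ (smoothCoeff B t)‖ ≤ M ∧ ‖smoothCoeff B' t‖ ≤ M := by
    intro p hp
    obtain ⟨η, hη, hBη⟩ := hloc p hp
    obtain ⟨M, hM⟩ := isCompact_Icc.exists_bound_of_continuousOn hη
    refine ⟨M, fun t ht => ?_⟩
    rw [(hBη t ht).1, (hBη t ht).2]
    exact ⟨hM t (Ioo_subset_Icc_self ht), hM t (Ioo_subset_Icc_self ht)⟩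
  choose! m hm using hbdd
  obtain ⟨M₁, hM₁⟩ := (hS.image m).bddAbove
  obtain ⟨M₂, hM₂⟩ := (hD.image fun t => ‖φ (smoothCoeff B t)‖ ⊔ ‖smoothCoeff B' t‖).bddAbove
  refine ⟨M₁ ⊔ M₂, fun t ht => ?_, D, hD, fun t ht htD => ?_⟩
  -- At the exceptional points the coefficients are unrelated, but there are only finitely many
  -- values to bound.
  · by_cases htD : t ∈ D
    · have := hM₂ (mem_image_of_mem _ htD)
      exact ⟨(le_sup_left.trans this).trans le_sup_right,
        (le_sup_right.trans this).trans le_sup_right⟩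
    · obtain ⟨p, hp, htp⟩ := hcov t (Ioo_subset_Icc_self ht) htD
      have := hM₁ (mem_image_of_mem m hp)
      exact ⟨((hm p hp t htp).1.trans this).trans le_sup_left,
        ((hm p hp t htp).2.trans this).trans le_sup_left⟩
  · obtain ⟨p, hp, htp⟩ := hcov t (Ioo_subset_Icc_self ht) htD
    obtain ⟨η, hη, hBη⟩ := hloc p hp
    have hηt := hη.continuousAt (Icc_mem_nhds htp.1 htp.2)
    have hnh := Ioo_mem_nhds htp.1 htp.2
    refine ⟨hηt.congr ?_, hηt.congr ?_, (hBη t htp).1.trans (hBη t htp).2.symm⟩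
    · filter_upwards [hnh] with s hs using (hBη s hs).1.symm
    · filter_upwards [hnh] with s hs using (hBη s hs).2.symm

/-- If `σ` is affine on `Z` and maps `Z` to a set on which `A` is smooth, then the pullback of `A`
is smooth on `Z`. -/
lemma isSmoothFormOn_pullbackForm {A : V → V → E} {Z : Set V} (hA : IsSmoothFormOn Z A)
    (φ : E →L[ℝ] F) {σ : ℝ → V} {K : Set ℝ} {g : ℝ →ᵃ[ℝ] V} (hg : EqOn σ g K)
    (hσ : MapsTo σ K Z) : IsSmoothFormOn K (pullbackForm σ φ A) := by
  refine (hA.comp_affine g φ (Z' := K) fun t ht => hg ht ▸ hσ ht).congr fun t w h => ?_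
  rw [pullbackForm, dirDeriv_of_affine hg h, hg h.mem]

/-- Composing a piecewise linear path with a piecewise linear map: the pullback form can be computed
in one step or in two. -/
lemma exists_almostEqual_comp {X : Set V} {Y : Set W} {A : V → V → E}
    (hA : IsPiecewiseSmoothForm X A) {f : W → V} (hf : IsPLMap Y X f) (φ : E →L[ℝ] F)
    {σ : ℝ → W} (hσ : IsPLMap unitSegment Y σ) :
    (∃ M, AlmostEqual M (smoothCoeff (pullbackForm (f ∘ σ) (ContinuousLinearMap.id ℝ E) A))
      (smoothCoeff (pullbackForm (f ∘ σ) (ContinuousLinearMap.id ℝ E) A))) ∧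
    ∃ M, AlmostEqual M
      (fun t => φ (smoothCoeff (pullbackForm (f ∘ σ) (ContinuousLinearMap.id ℝ E) A) t))
      (smoothCoeff (pullbackForm σ (ContinuousLinearMap.id ℝ F) (pullbackForm f φ A))) := by
  obtain ⟨T, hT, hA⟩ := hA
  obtain ⟨hfX, Tf, hTf, hf⟩ := hf
  have hσY := hσ.1
  obtain ⟨𝒦, hfin, hcov, h𝒦⟩ := hσ.isPiecewise
  have h0 : IsPiecewise σ fun K => ∃ g : ℝ →ᵃ[ℝ] W, EqOn σ g K :=
    ⟨𝒦, hfin, hcov, fun K hK => by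
      obtain ⟨h1, h2, h3, h4, -⟩ := h𝒦 K hK
      exact ⟨h1, h2, h3, h4, h4⟩⟩
  -- First cut so that each piece maps into one simplex of `Tf`, which makes `f ∘ σ` affine; then
  -- cut again by the simplices of `T`, on which `A` is smooth.
  have h1 := h0.refine (fun K hK => hK) (Q := fun K => ∃ g : ℝ →ᵃ[ℝ] W, EqOn σ g K)
    (fun K K' hKK' ⟨g, hg⟩ => ⟨g, hg.mono hKK'⟩) hTf hσY
  have haff : ∀ K : Set ℝ, ((∃ g : ℝ →ᵃ[ℝ] W, EqOn σ g K) ∧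
      ∃ s ∈ Tf.faces, MapsTo σ K (convexHull ℝ (s : Set W))) →
      ∃ g : ℝ →ᵃ[ℝ] V, EqOn (f ∘ σ) g K := by
    rintro K ⟨⟨g, hg⟩, s, hs, hmaps⟩
    obtain ⟨g', hg'⟩ := hf s hs
    refine ⟨g'.comp g, fun t ht => ?_⟩
    rw [Function.comp_apply, hg' (hmaps ht), hg ht]
    rfl
  obtain ⟨S, hS, hSp, D, hD, hcovD⟩ := (h1.refine haff
    (Q := fun K => ∃ g : ℝ →ᵃ[ℝ] V, EqOn (f ∘ σ) g K)
    (fun K K' hKK' hK => (haff K hK).imp fun g hg => hg.mono hKK') hT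
    (hfX.comp hσY)).exists_intervals
  have hsmooth : ∀ p ∈ S, IsSmoothFormOn (Icc p.1 p.2)
      (pullbackForm (f ∘ σ) (ContinuousLinearMap.id ℝ E) A) := by
    intro p hp
    obtain ⟨-, -, ⟨g, hg⟩, s, hs, hmaps⟩ := hSp p hp
    exact isSmoothFormOn_pullbackForm (hA s hs) _ hg hmaps
  refine ⟨exists_almostEqual (ContinuousLinearMap.id ℝ E) hS
    (fun p hp => ⟨(hSp p hp).1, hsmooth p hp, fun _ _ _ => rfl⟩) hD hcovD,
    exists_almostEqual φ hS (fun p hp => ⟨(hSp p hp).1, hsmooth p hp, fun t w htw => ?_⟩) hD hcovD⟩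
  obtain ⟨g, hg⟩ := (hSp p hp).2.1
  simp only [pullbackForm, dirDeriv_comp_of_affine hg f htw, dirDeriv_of_affine hg htw,
    ContinuousLinearMap.id_apply, Function.comp_apply]

/-- The coefficient of a piecewise smooth form along a piecewise linear path is bounded, and
continuous off a finite set. -/
lemma exists_almostEqual_pullbackForm {X : Set V} {A : V → V → E} (hA : IsPiecewiseSmoothForm X A)
    {σ : ℝ → V} (hσ : IsPLMap unitSegment X σ) :
    ∃ M, AlmostEqual M (smoothCoeff (pullbackForm σ (ContinuousLinearMap.id ℝ E) A))
      (smoothCoeff (pullbackForm σ (ContinuousLinearMap.id ℝ E) A)) := by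
  obtain ⟨T, hT, -⟩ := id hA
  have hid : IsPLMap X X (id : V → V) :=
    ⟨mapsTo_id X, T, hT, fun s _ => ⟨AffineMap.id ℝ V, fun x _ => rfl⟩⟩
  exact (exists_almostEqual_comp hA hid (ContinuousLinearMap.id ℝ E) hσ).1

/-! ### Reparametrization -/

/-- The scaling is moved into the tangent vector, so no differentiability of `σ` is needed. -/
lemma pullbackForm_comp_leftHalf (σ : ℝ → V) (A : V → V → E) (t w : ℝ) :
    pullbackForm (σ ∘ fun t : ℝ => t / 2) (ContinuousLinearMap.id ℝ E) A t w =
      pullbackForm σ (ContinuousLinearMap.id ℝ E) A (t / 2) (w / 2) := by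
  simp only [pullbackForm, dirDeriv, Function.comp_apply, smul_eq_mul, add_div, mul_div_assoc]

lemma pullbackForm_comp_rightHalf (σ : ℝ → V) (A : V → V → E) (t w : ℝ) :
    pullbackForm (σ ∘ fun t : ℝ => (1 + t) / 2) (ContinuousLinearMap.id ℝ E) A t w =
      pullbackForm σ (ContinuousLinearMap.id ℝ E) A ((1 + t) / 2) (w / 2) := by
  simp only [pullbackForm, dirDeriv, Function.comp_apply, smul_eq_mul]
  congr 3; ext s; congr 1; ring

lemma pullbackForm_comp_flipSegment (σ : ℝ → V) (A : V → V → E) (t w : ℝ) :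
    pullbackForm (σ ∘ flipSegment) (ContinuousLinearMap.id ℝ E) A t w =
      pullbackForm σ (ContinuousLinearMap.id ℝ E) A (1 - t) (-w) := by
  simp only [pullbackForm, dirDeriv, Function.comp_apply, smul_eq_mul, flipSegment]
  congr 3; ext s; congr 1; ring

/-- The value of a form at a smooth point is homogeneous. -/
lemma IsSmoothPoint.apply_eq_smul {B : ℝ → ℝ → E} {t : ℝ} (h : IsSmoothPoint B t) (w : ℝ) :
    B t w = w • B t 1 := by
  obtain ⟨a, b, ha, hb, -, U, η, -, -, -, h⟩ := h
  rw [h t w (pointsInto_of_mem_Ioo ⟨ha, hb⟩ w), h t 1 (pointsInto_of_mem_Ioo ⟨ha, hb⟩ 1),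
    ← map_smul, smul_eq_mul, mul_one]

/-- Smooth points are preserved by affine reparametrizations of the interval. -/
lemma IsSmoothPoint.comp_affine {B B' : ℝ → ℝ → E} {t m k : ℝ}
    (hB : ∀ s w, B' s w = B (m * s + k) (m * w)) (h : IsSmoothPoint B (m * t + k))
    (ht : t ∈ Ioo (0 : ℝ) 1) : IsSmoothPoint B' t := by
  obtain ⟨a, b, ha, hb, -, h⟩ := h
  have hc : ContinuousAt (fun s : ℝ => m * s + k) t := by fun_prop
  have hmem : (fun s : ℝ => m * s + k) ⁻¹' Icc a b ∩ Icc 0 1 ∈ 𝓝 t :=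
    inter_mem (hc.preimage_mem_nhds (Icc_mem_nhds ha hb)) (Icc_mem_nhds ht.1 ht.2)
  obtain ⟨ε, hε, hball⟩ := Metric.nhds_basis_closedBall.mem_iff.1 hmem
  rw [Real.closedBall_eq_Icc] at hball
  refine ⟨t - ε, t + ε, by linarith, by linarith, fun s hs => (hball hs).2, ?_⟩
  let g : ℝ →ᵃ[ℝ] ℝ := (m • AffineMap.id ℝ ℝ) + AffineMap.const ℝ ℝ k
  have hg : ∀ s, g s = m * s + k := fun s => by simp [g]
  have hgl : ∀ s, g.linear s = m * s := fun s => by simp [g]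
  refine (h.comp_affine g (ContinuousLinearMap.id ℝ E) (Z' := Icc (t - ε) (t + ε))
    fun s hs => ?_).congr fun s w _ => ?_
  · rw [hg]; exact (hball hs).1
  · rw [hg, hgl, hB]; rfl

lemma isSmoothPoint_comp_affine_iff {B B' : ℝ → ℝ → E} {t m k : ℝ} (hm : m ≠ 0)
    (hB : ∀ s w, B' s w = B (m * s + k) (m * w))
    (ht : t ∈ Ioo (0 : ℝ) 1) (ht' : m * t + k ∈ Ioo (0 : ℝ) 1) :
    IsSmoothPoint B' t ↔ IsSmoothPoint B (m * t + k) := by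
  refine ⟨fun h => ?_, fun h => h.comp_affine hB ht⟩
  -- The converse is the same statement for the inverse affine map.
  refine IsSmoothPoint.comp_affine (B := B') (m := m⁻¹) (k := -(m⁻¹ * k))
    (fun s w => ?_) ?_ ht'
  · rw [hB]; congr 1 <;> field_simp; ring
  · convert h using 1; field_simp; ring

lemma smoothCoeff_comp_affine {B B' : ℝ → ℝ → E} {t m k : ℝ} (hm : m ≠ 0)
    (hB : ∀ s w, B' s w = B (m * s + k) (m * w))
    (ht : t ∈ Ioo (0 : ℝ) 1) (ht' : m * t + k ∈ Ioo (0 : ℝ) 1) :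
    smoothCoeff B' t = m • smoothCoeff B (m * t + k) := by
  have := isSmoothPoint_comp_affine_iff hm hB ht ht'
  by_cases h : IsSmoothPoint B (m * t + k)
  · simp only [smoothCoeff, this.2 h, h, if_true, hB, mul_one, h.apply_eq_smul m]
  · simp only [smoothCoeff, mt this.1 h, h, if_false, smul_zero]

lemma smoothCoeff_comp_leftHalf (σ : ℝ → V) (A : V → V → E) :
    EqOn (smoothCoeff (pullbackForm (σ ∘ fun t : ℝ => t / 2) (ContinuousLinearMap.id ℝ E) A))
      (leftHalf (smoothCoeff (pullbackForm σ (ContinuousLinearMap.id ℝ E) A))) (Ioo 0 1) := by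
  intro t ht
  have heq : (1 / 2 : ℝ) * t + 0 = t / 2 := by ring
  rw [smoothCoeff_comp_affine (m := 1 / 2) (k := 0) (by norm_num)
    (fun s w => by rw [pullbackForm_comp_leftHalf]; congr 1 <;> ring) ht
    (heq ▸ left_mem_Ioo ht), heq, leftHalf]

lemma smoothCoeff_comp_rightHalf (σ : ℝ → V) (A : V → V → E) :
    EqOn (smoothCoeff (pullbackForm (σ ∘ fun t : ℝ => (1 + t) / 2) (ContinuousLinearMap.id ℝ E) A))
      (rightHalf (smoothCoeff (pullbackForm σ (ContinuousLinearMap.id ℝ E) A))) (Ioo 0 1) := by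
  intro t ht
  have heq : (1 / 2 : ℝ) * t + 1 / 2 = (1 + t) / 2 := by ring
  rw [smoothCoeff_comp_affine (m := 1 / 2) (k := 1 / 2) (by norm_num)
    (fun s w => by rw [pullbackForm_comp_rightHalf]; congr 1 <;> ring) ht
    (heq ▸ right_mem_Ioo ht), heq, rightHalf]

lemma smoothCoeff_comp_flipSegment (σ : ℝ → V) (A : V → V → E) :
    EqOn (smoothCoeff (pullbackForm (σ ∘ flipSegment) (ContinuousLinearMap.id ℝ E) A))
      (fun t => -smoothCoeff (pullbackForm σ (ContinuousLinearMap.id ℝ E) A) (1 - t))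
      (Ioo 0 1) := by
  intro t ht
  have heq : (-1 : ℝ) * t + 1 = 1 - t := by ring
  have ht' : 1 - t ∈ Ioo (0 : ℝ) 1 := ⟨by linarith [ht.2], by linarith [ht.1]⟩
  simp only
  rw [smoothCoeff_comp_affine (m := -1) (k := 1) (by norm_num)
    (fun s w => by rw [pullbackForm_comp_flipSegment]; congr 1 <;> ring) ht
    (heq ▸ ht'), heq, neg_one_smul]

end Pullback

/-! ### The exponential map -/

section LieExp

variable {E : Type*} [NormedAddCommGroup E] [NormedSpace ℝ E]
  {G : Type*} [TopologicalSpace G] [ChartedSpace E G] [Group G]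
  {F : Type*} [NormedAddCommGroup F] [NormedSpace ℝ F]
  {H : Type*} [TopologicalSpace H] [ChartedSpace F H] [Group H]

/-- The left invariant vector field with value `v` at `1`. -/
abbrev leftInvField (G : Type*) [TopologicalSpace G] [ChartedSpace E G] [Group G] (v : E) (g : G) :
    TangentSpace 𝓘(ℝ, E) g :=
  mulInvariantVectorField (I := 𝓘(ℝ, E)) (G := G) (v : GroupLieAlgebra 𝓘(ℝ, E) G) g

lemma isManifold_of_lieGroup [LieGroup 𝓘(ℝ, E) ∞ G] : IsManifold 𝓘(ℝ, E) 1 G :=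
  IsManifold.of_le (n := ∞) (by norm_cast)

lemma contMDiff_leftInvField [LieGroup 𝓘(ℝ, E) ∞ G] (v : E) :
    ContMDiff 𝓘(ℝ, E) 𝓘(ℝ, E).tangent 1
      (fun g : G => (⟨g, leftInvField G v g⟩ : TangentBundle 𝓘(ℝ, E) G)) := by
  have : LieGroup 𝓘(ℝ, E) (minSmoothness ℝ 3) G := by
    rw [minSmoothness_of_isRCLikeNormedField]
    exact LieGroup.of_le (n := ∞) (by norm_cast)
  have := contMDiff_mulInvariantVectorField (I := 𝓘(ℝ, E)) (G := G)
    (v : GroupLieAlgebra 𝓘(ℝ, E) G)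
  refine this.of_le ?_
  rw [minSmoothness_of_isRCLikeNormedField]
  norm_num

lemma ContinuousLinearMap.comp_smulRight_one (L : E →L[ℝ] F) (x : E) :
    L.comp ((1 : ℝ →L[ℝ] ℝ).smulRight x) = (1 : ℝ →L[ℝ] ℝ).smulRight (L x) := by
  ext; simp

omit [Group G] [Group H] in
/-- Maps that relate two vector fields map integral curves to integral curves. -/
lemma isMIntegralCurveOn_comp {f : G → H} (hf : MDifferentiable 𝓘(ℝ, E) 𝓘(ℝ, F) f)
    {X : (g : G) → TangentSpace 𝓘(ℝ, E) g} {Y : (h : H) → TangentSpace 𝓘(ℝ, F) h}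
    (hXY : ∀ g, mfderiv 𝓘(ℝ, E) 𝓘(ℝ, F) f g (X g) = Y (f g)) {γ : ℝ → G} {s : Set ℝ}
    (hγ : IsMIntegralCurveOn (I := 𝓘(ℝ, E)) γ X s) :
    IsMIntegralCurveOn (I := 𝓘(ℝ, F)) (f ∘ γ) Y s := by
  intro t ht
  refine ((hf (γ t)).hasMFDerivAt.comp_hasMFDerivWithinAt t (hγ t ht)).congr_mfderiv ?_
  rw [Function.comp_apply, ← hXY]
  exact ContinuousLinearMap.comp_smulRight_one (E := E) (F := F) _ _

omit [Group G] [Group H] in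
lemma isMIntegralCurve_comp {f : G → H} (hf : MDifferentiable 𝓘(ℝ, E) 𝓘(ℝ, F) f)
    {X : (g : G) → TangentSpace 𝓘(ℝ, E) g} {Y : (h : H) → TangentSpace 𝓘(ℝ, F) h}
    (hXY : ∀ g, mfderiv 𝓘(ℝ, E) 𝓘(ℝ, F) f g (X g) = Y (f g)) {γ : ℝ → G}
    (hγ : IsMIntegralCurve (I := 𝓘(ℝ, E)) γ X) :
    IsMIntegralCurve (I := 𝓘(ℝ, F)) (f ∘ γ) Y := by
  rw [isMIntegralCurve_iff_isMIntegralCurveOn] at hγ ⊢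
  exact isMIntegralCurveOn_comp hf hXY hγ

lemma mdifferentiable_mulLeft [LieGroup 𝓘(ℝ, E) ∞ G] (g : G) :
    MDifferentiable 𝓘(ℝ, E) 𝓘(ℝ, E) (g * ·) :=
  (contMDiff_mul_left (I := 𝓘(ℝ, E)) (n := ∞) (a := g)).mdifferentiable (by simp)

-- The chain rule with the intermediate point as a separate variable `h`, so that no rewriting
-- inside the type of a tangent space is needed.
omit [Group G] [Group H] in
lemma mfderiv_comp_eq_apply {F' : Type*} [NormedAddCommGroup F'] [NormedSpace ℝ F']
    {K : Type*} [TopologicalSpace K] [ChartedSpace F' K] {f : H → K} {k : G → H} {v : E} {g : G}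
    {h : H} (hf : MDifferentiable 𝓘(ℝ, F) 𝓘(ℝ, F') f) (hk : MDifferentiable 𝓘(ℝ, E) 𝓘(ℝ, F) k)
    (hkg : k g = h) :
    (mfderiv 𝓘(ℝ, E) 𝓘(ℝ, F') (f ∘ k) g : E →L[ℝ] F') v =
      (mfderiv 𝓘(ℝ, F) 𝓘(ℝ, F') f h : F →L[ℝ] F')
        ((mfderiv 𝓘(ℝ, E) 𝓘(ℝ, F) k g : E →L[ℝ] F) v) := by
  subst hkg
  rw [mfderiv_comp g (hf _) (hk g)]
  rfl

lemma mfderiv_leftInvField [LieGroup 𝓘(ℝ, E) ∞ G] (v : E) (g h : G) :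
    mfderiv 𝓘(ℝ, E) 𝓘(ℝ, E) (g * ·) h (leftInvField G v h) = leftInvField G v (g * h) := by
  have : (fun x : G => g * h * x) = (g * ·) ∘ (h * ·) := by ext x; simp [mul_assoc]
  simp only [leftInvField, mulInvariantVectorField]
  rw [this]
  exact (mfderiv_comp_eq_apply (mdifferentiable_mulLeft g) (mdifferentiable_mulLeft h)
    (mul_one h)).symm

/-- A homomorphism of Lie groups relates left invariant vector fields. -/
lemma mfderiv_leftInvField_hom [LieGroup 𝓘(ℝ, E) ∞ G] [LieGroup 𝓘(ℝ, F) ∞ H] {Φ : G →* H}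
    (hΦ : MDifferentiable 𝓘(ℝ, E) 𝓘(ℝ, F) Φ) (v : E) (g : G) :
    mfderiv 𝓘(ℝ, E) 𝓘(ℝ, F) Φ g (leftInvField G v g) =
      leftInvField H (lieMap E F Φ v) (Φ g) := by
  have : Φ ∘ (g * ·) = (Φ g * ·) ∘ Φ := by ext x; simp
  have h1 := mfderiv_comp_eq_apply (v := v) hΦ (mdifferentiable_mulLeft g) (mul_one g)
  have h2 := mfderiv_comp_eq_apply (v := v) (mdifferentiable_mulLeft (Φ g)) hΦ (map_one Φ)
  rw [this] at h1
  exact h1.symm.trans h2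

lemma leftInvField_smul (a : ℝ) (v : E) :
    (fun g : G => leftInvField G (a • v) g) = a • fun g : G => leftInvField G v g := by
  funext g
  exact ((mfderiv 𝓘(ℝ, E) 𝓘(ℝ, E) (g * ·) (1 : G) : E →L[ℝ] E)).map_smul a v

lemma leftInvField_one (v : E) : leftInvField G v 1 = v := by
  simp only [leftInvField, mulInvariantVectorField]
  have : (fun x : G => 1 * x) = id := by ext x; simp
  rw [this, mfderiv_id]
  rfl

variable [FiniteDimensional ℝ E] [T2Space G] [LieGroup 𝓘(ℝ, E) ∞ G]

/-- Left invariant vector fields are complete. -/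
lemma exists_isMIntegralCurve_leftInvField (v : E) :
    ∃ γ : ℝ → G, γ 0 = 1 ∧ IsMIntegralCurve (I := 𝓘(ℝ, E)) γ (leftInvField G v) := by
  have := isManifold_of_lieGroup (E := E) (G := G)
  have := FiniteDimensional.complete ℝ E
  have hv := contMDiff_leftInvField (G := G) v
  obtain ⟨γ, h0, hγ⟩ := exists_isMIntegralCurveAt_of_contMDiffAt_boundaryless (I := 𝓘(ℝ, E)) 0
    (hv.contMDiffAt (x := 1))
  obtain ⟨ε, hε, hγ⟩ := isMIntegralCurveAt_iff'.1 hγ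
  refine exists_isMIntegralCurve_of_isMIntegralCurveOn hv hε (fun g => ?_) 1
  refine ⟨(g * ·) ∘ γ, by simp [h0], ?_⟩
  -- Left translation carries the local curve at `1` to every `g` with the same `ε`; a uniform
  -- existence time gives completeness.
  rw [Real.ball_eq_Ioo, zero_sub, zero_add] at hγ
  exact isMIntegralCurveOn_comp (mdifferentiable_mulLeft g) (mfderiv_leftInvField v g) hγ

lemma leftInvField_curve_unique {v : E} {γ γ' : ℝ → G} (h : γ 0 = γ' 0)
    (hγ : IsMIntegralCurve (I := 𝓘(ℝ, E)) γ (leftInvField G v))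
    (hγ' : IsMIntegralCurve (I := 𝓘(ℝ, E)) γ' (leftInvField G v)) : γ = γ' := by
  have := isManifold_of_lieGroup (E := E) (G := G)
  have := FiniteDimensional.complete ℝ E
  exact isMIntegralCurve_Ioo_eq_of_contMDiff_boundaryless (contMDiff_leftInvField (G := G) v)
    hγ hγ' h

lemma lieExp_eq {v : E} {γ : ℝ → G} (h0 : γ 0 = 1)
    (hγ : IsMIntegralCurve (I := 𝓘(ℝ, E)) γ (leftInvField G v)) : lieExp G v = γ 1 := by
  have h : ∃ γ : ℝ → G, γ 0 = 1 ∧ IsMIntegralCurve (I := 𝓘(ℝ, E)) γ (leftInvField G v) :=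
    ⟨γ, h0, hγ⟩
  unfold lieExp
  rw [dif_pos h]
  exact congrFun (leftInvField_curve_unique (h.choose_spec.1.trans h0.symm) h.choose_spec.2 hγ) 1

/-- Both sides, as functions of `t`, are integral curves of the same field through `γ s`. -/
lemma leftInvField_curve_add {v : E} {γ : ℝ → G} (h0 : γ 0 = 1)
    (hγ : IsMIntegralCurve (I := 𝓘(ℝ, E)) γ (leftInvField G v)) (s t : ℝ) :
    γ (s + t) = γ s * γ t := by
  have h1 := hγ.comp_add s
  have h2 := isMIntegralCurve_comp (mdifferentiable_mulLeft (γ s)) (mfderiv_leftInvField v (γ s)) hγ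
  have := congrFun (leftInvField_curve_unique (by simp [h0]) h1 h2) t
  simpa [add_comm] using this

lemma lieExp_zero : lieExp G (0 : E) = 1 := by
  refine lieExp_eq (γ := fun _ => 1) rfl (isMIntegralCurve_const ?_)
  exact leftInvField_one 0

lemma lieExp_neg (v : E) : lieExp G (-v) = (lieExp G v)⁻¹ := by
  obtain ⟨γ, h0, hγ⟩ := exists_isMIntegralCurve_leftInvField (G := G) v
  have h1 := hγ.comp_mul (-1)
  have h2 : IsMIntegralCurve (I := 𝓘(ℝ, E)) (γ ∘ (· * (-1))) (leftInvField G (-v)) := by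
    have := leftInvField_smul (G := G) (-1) v
    rw [neg_one_smul] at this
    rw [show (leftInvField G (-v)) = (fun g : G => leftInvField G (-v) g) from rfl, this]
    exact h1
  rw [lieExp_eq h0 hγ, lieExp_eq (by simp [h0]) h2]
  refine eq_inv_of_mul_eq_one_left ?_
  have := leftInvField_curve_add h0 hγ (-1) 1
  rw [neg_add_cancel, h0] at this
  simpa using this.symm

lemma map_lieExp [FiniteDimensional ℝ F] [T2Space H] [LieGroup 𝓘(ℝ, F) ∞ H] {Φ : G →* H}
    (hΦ : MDifferentiable 𝓘(ℝ, E) 𝓘(ℝ, F) Φ) (v : E) :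
    Φ (lieExp G v) = lieExp H (lieMap E F Φ v) := by
  obtain ⟨γ, h0, hγ⟩ := exists_isMIntegralCurve_leftInvField (G := G) v
  rw [lieExp_eq h0 hγ]
  exact (lieExp_eq (by simp [h0])
    (isMIntegralCurve_comp hΦ (mfderiv_leftInvField_hom hΦ v) hγ)).symm

end LieExp

/-! ### The logarithmic chart of a Lie group -/

section LogChartExists

variable {E : Type*} [NormedAddCommGroup E] [NormedSpace ℝ E]

/-- The mixed second difference of a `C²` function of two variables. -/
lemma ContDiffAt.exists_norm_second_difference_le {F : Type*} [NormedAddCommGroup F]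
    [NormedSpace ℝ F] {m : E × E → F} (hm : ContDiffAt ℝ 2 m 0) :
    ∃ r > 0, ∃ C > 0, ∀ a b x y : E, ‖a‖ ≤ r → ‖b‖ ≤ r → ‖x‖ ≤ r → ‖y‖ ≤ r →
      ‖m (a, x) - m (b, x) - (m (a, y) - m (b, y))‖ ≤ C * ‖a - b‖ * ‖x - y‖ := by
  obtain ⟨K, t, ht, hK⟩ := (hm.fderiv_right (m := 1) (by norm_num)).exists_lipschitzOnWith
  have hd : ∀ᶠ z in 𝓝 (0 : E × E), DifferentiableAt ℝ m z := by
    filter_upwards [hm.eventually (by simp)] with z hz using hz.differentiableAt (by simp)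
  obtain ⟨r, hr, hball⟩ := Metric.nhds_basis_closedBall.mem_iff.1 (inter_mem ht hd)
  have hmem : ∀ a x : E, ‖a‖ ≤ r → ‖x‖ ≤ r → (a, x) ∈ t ∧ DifferentiableAt ℝ m (a, x) :=
    fun a x ha hx => hball (by
      rw [mem_closedBall_zero_iff, Prod.norm_def]; exact max_le ha hx)
  -- The mean value inequality is applied to `z ↦ m (z, x) - m (z, y)`, whose derivative is small
  -- because `fderiv ℝ m` is Lipschitz. `K + 1` keeps the constant positive.
  refine ⟨r, hr, K + 1, by positivity, fun a b x y ha hb hx hy => ?_⟩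
  have hderiv : ∀ z ∈ Metric.closedBall (0 : E) r,
      HasFDerivWithinAt (fun z => m (z, x) - m (z, y))
        ((fderiv ℝ m (z, x) - fderiv ℝ m (z, y)).comp (ContinuousLinearMap.inl ℝ E E))
        (Metric.closedBall 0 r) z := by
    intro z hz
    rw [mem_closedBall_zero_iff] at hz
    have h1 := (hmem z x hz hx).2.hasFDerivAt.comp (f := fun z => (z, x)) z
      (hasFDerivAt_prodMk_left z x)
    have h2 := (hmem z y hz hy).2.hasFDerivAt.comp (f := fun z => (z, y)) z
      (hasFDerivAt_prodMk_left z y)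
    exact (h1.sub h2).hasFDerivWithinAt
  have hbound : ∀ z ∈ Metric.closedBall (0 : E) r,
      ‖(fderiv ℝ m (z, x) - fderiv ℝ m (z, y)).comp (ContinuousLinearMap.inl ℝ E E)‖ ≤
        (K + 1) * ‖x - y‖ := by
    intro z hz
    rw [mem_closedBall_zero_iff] at hz
    have h1 := hK.dist_le_mul _ (hmem z x hz hx).1 _ (hmem z y hz hy).1
    rw [dist_eq_norm, dist_eq_norm, Prod.mk_sub_mk, sub_self, Prod.norm_mk, norm_zero,
      max_eq_right (norm_nonneg _)] at h1
    have h2 := ContinuousLinearMap.opNorm_comp_le (fderiv ℝ m (z, x) - fderiv ℝ m (z, y))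
      (ContinuousLinearMap.inl ℝ E E)
    have h3 := ContinuousLinearMap.norm_inl_le_one ℝ E E
    nlinarith [norm_nonneg (fderiv ℝ m (z, x) - fderiv ℝ m (z, y)), norm_nonneg (x - y)]
  have := (convex_closedBall (0 : E) r).norm_image_sub_le_of_norm_hasFDerivWithin_le hderiv hbound
    (mem_closedBall_zero_iff.2 hb) (mem_closedBall_zero_iff.2 ha)
  calc _ = ‖m (a, x) - m (a, y) - (m (b, x) - m (b, y))‖ := by congr 1; abel
    _ ≤ _ := this
    _ = _ := by ring

/-! ### One-parameter subgroups in a chart. -/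

section FirstExit

variable {G : Type*} [TopologicalSpace G] [Group G] [T2Space G] [FiniteDimensional ℝ E]
  {ψ : OpenPartialHomeomorph G E} {r C : ℝ}

omit [T2Space G] [FiniteDimensional ℝ E] in
/-- In a chart with `C * r ≤ 1`, the velocity of a one-parameter subgroup varies slowly. -/
lemma IsMulChart.norm_deriv_sub_le (hψ : IsMulChart ψ r C) {γ : ℝ → G} {v w : E} {t : ℝ}
    (hadd : ∀ s t, γ (s + t) = γ s * γ t) (hcont : Continuous γ)
    (hv : HasDerivAt (ψ ∘ γ) v 0) (hw : HasDerivAt (ψ ∘ γ) w t)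
    (ht : γ t ∈ ψ.source) (htr : ‖ψ (γ t)‖ ≤ r) : ‖w - v‖ ≤ C * ‖ψ (γ t)‖ * ‖v‖ := by
  have h0 : γ 0 = 1 := by simpa using hadd 0 0
  have l1 := hw.tendsto_slope_zero
  have l2 := hv.tendsto_slope_zero
  refine le_of_tendsto_of_tendsto (l1.sub l2).norm (l2.norm.const_mul (C * ‖ψ (γ t)‖)) ?_
  have hO : IsOpen (ψ.source ∩ ψ ⁻¹' Metric.ball 0 r) := ψ.isOpen_inter_preimage Metric.isOpen_ball
  have hmem : ∀ᶠ s in 𝓝 (0 : ℝ), γ s ∈ ψ.source ∩ ψ ⁻¹' Metric.ball 0 r := by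
    refine hcont.continuousAt.eventually (hO.mem_nhds ?_)
    rw [h0]
    exact ⟨hψ.one_mem, by simp [hψ.map_one, hψ.pos]⟩
  filter_upwards [nhdsWithin_le_nhds hmem] with s hs
  have h1 : ‖ψ 1‖ ≤ r := by rw [hψ.map_one, norm_zero]; exact hψ.pos.le
  have hsr : ‖ψ (γ s)‖ ≤ r := (mem_ball_zero_iff.1 hs.2).le
  -- Compare `γ (t + s) = γ t * γ s` with `γ s`, then divide by `s` and let `s → 0`.
  have key := hψ.norm_sub_le ht htr hψ.one_mem h1 hs.1 hsr hψ.one_mem h1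
  simp only [one_mul, mul_one, hψ.map_one, sub_zero] at key
  simp only [Function.comp_apply, zero_add, h0, hψ.map_one, sub_zero, hadd t s]
  rw [← smul_sub, norm_smul, norm_smul, sub_right_comm]
  calc _ ≤ ‖s⁻¹‖ * (C * ‖ψ (γ t)‖ * ‖ψ (γ s)‖) := by gcongr
    _ = _ := by ring

/-- In a suitable chart, one-parameter subgroups with a small velocity stay in the chart for all
times in `[0, 1]`, and agree with straight lines up to second order. -/
lemma IsMulChart.norm_oneParam_sub_le (hψ : IsMulChart ψ r C) (hr : C * r ≤ 1) {γ : ℝ → G} {v : E}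
    (hadd : ∀ s t, γ (s + t) = γ s * γ t) (hcont : Continuous γ)
    (hdiff : ∀ t, γ t ∈ ψ.source → DifferentiableAt ℝ (ψ ∘ γ) t)
    (hv : HasDerivAt (ψ ∘ γ) v 0) (hvr : 2 * ‖v‖ < r) :
    γ 1 ∈ ψ.source ∧ ‖ψ (γ 1) - v‖ ≤ 2 * C * ‖v‖ ^ 2 := by
  have hC := hψ.const_pos
  have h0 : γ 0 = 1 := by simpa using hadd 0 0
  have hc0 : (ψ ∘ γ) 0 = 0 := by simp [h0, hψ.map_one]
  have hgrow : ∀ T : ℝ, (∀ t ∈ Icc 0 T, γ t ∈ ψ.source ∧ ‖ψ (γ t)‖ ≤ r) →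
      ∀ t ∈ Icc 0 T, ‖ψ (γ t)‖ ≤ 2 * ‖v‖ * t := by
    intro T hT t ht
    have := norm_image_sub_le_of_norm_deriv_le_segment' (f := ψ ∘ γ) (C := 2 * ‖v‖)
      (fun s hs => ((hdiff s (hT s hs).1).hasDerivAt).hasDerivWithinAt) (fun s hs => ?_) t ht
    · simpa only [hc0, sub_zero, Function.comp_apply] using this
    · obtain ⟨h1, h2⟩ := hT s (Ico_subset_Icc_self hs)
      have h3 := hψ.norm_deriv_sub_le hadd hcont hv (hdiff s h1).hasDerivAt h1 h2
      have h4 : C * ‖ψ (γ s)‖ ≤ 1 := (mul_le_mul_of_nonneg_left h2 hC.le).trans hr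
      have h5 := norm_add_le (deriv (ψ ∘ γ) s - v) v
      rw [sub_add_cancel] at h5
      nlinarith [norm_nonneg v]
  have hO : IsOpen (ψ.source ∩ ψ ⁻¹' Metric.ball 0 r) := ψ.isOpen_inter_preimage Metric.isOpen_ball
  -- First exit argument: at the first exit time `T ≤ 1` the growth bound still gives `‖ψ (γ T)‖ ≤ 2
  -- * ‖v‖ < r`, a contradiction.
  have hstay : ∀ t ∈ Icc (0 : ℝ) 1, γ t ∈ ψ.source ∩ ψ ⁻¹' Metric.ball 0 r := by
    by_contra! hexit
    set A := Icc (0 : ℝ) 1 ∩ γ ⁻¹' (ψ.source ∩ ψ ⁻¹' Metric.ball 0 r)ᶜ with hA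
    have hAc : IsClosed A := isClosed_Icc.inter (hO.isClosed_compl.preimage hcont)
    have hAb : BddBelow A := ⟨0, fun t ht => ht.1.1⟩
    have hmem : sInf A ∈ A := hAc.csInf_mem hexit hAb
    set T := sInf A with hT
    have hbefore : ∀ t ∈ Ico 0 T, γ t ∈ ψ.source ∩ ψ ⁻¹' Metric.ball 0 r := by
      intro t ht
      by_contra hcon
      exact notMem_of_lt_csInf ht.2 hAb ⟨⟨ht.1, ht.2.le.trans hmem.1.2⟩, hcon⟩
    have hTpos : 0 < T := by
      refine lt_of_le_of_ne hmem.1.1 fun hT0 => hmem.2 ?_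
      rw [← hT0, h0]
      exact ⟨hψ.one_mem, by simp [hψ.map_one, hψ.pos]⟩
    -- The curve might leave the chart domain at `T` itself. Compactness of the ball and the
    -- Hausdorff property exclude this.
    have hZ : IsClosed (ψ.symm '' Metric.closedBall 0 r) :=
      ((isCompact_closedBall (0 : E) r).image_of_continuousOn
        (ψ.continuousOn_symm.mono hψ.closedBall_subset)).isClosed
    have hTZ : γ T ∈ ψ.symm '' Metric.closedBall 0 r := by
      have hlim : Tendsto γ (𝓝[<] T) (𝓝 (γ T)) := hcont.continuousAt.tendsto.mono_left
        nhdsWithin_le_nhds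
      refine hZ.mem_of_tendsto hlim ?_
      filter_upwards [Ico_mem_nhdsLT hTpos] with t ht
      obtain ⟨h1, h2⟩ := hbefore t ht
      exact ⟨ψ (γ t), Metric.ball_subset_closedBall h2, ψ.left_inv h1⟩
    obtain ⟨x, hx, hxT⟩ := hTZ
    have hxt := hψ.closedBall_subset hx
    have hTs : γ T ∈ ψ.source ∧ ‖ψ (γ T)‖ ≤ r := by
      rw [← hxT, ψ.right_inv hxt]
      exact ⟨ψ.map_target hxt, mem_closedBall_zero_iff.1 hx⟩
    have hall : ∀ t ∈ Icc 0 T, γ t ∈ ψ.source ∧ ‖ψ (γ t)‖ ≤ r := by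
      intro t ht
      rcases ht.2.lt_or_eq with h | h
      · obtain ⟨h1, h2⟩ := hbefore t ⟨ht.1, h⟩
        exact ⟨h1, (mem_ball_zero_iff.1 h2).le⟩
      · rw [h]; exact hTs
    have := hgrow T hall T ⟨hTpos.le, le_rfl⟩
    refine hmem.2 ⟨hTs.1, mem_ball_zero_iff.2 ?_⟩
    nlinarith [hmem.1.2, norm_nonneg v]
  have hall : ∀ t ∈ Icc (0 : ℝ) 1, γ t ∈ ψ.source ∧ ‖ψ (γ t)‖ ≤ r := fun t ht =>
    ⟨(hstay t ht).1, (mem_ball_zero_iff.1 (hstay t ht).2).le⟩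
  have h1 : (1 : ℝ) ∈ Icc (0 : ℝ) 1 := ⟨zero_le_one, le_rfl⟩
  refine ⟨(hall 1 h1).1, ?_⟩
  have := norm_image_sub_le_of_norm_deriv_le_segment' (f := fun t => (ψ ∘ γ) t - t • v)
    (f' := fun t => deriv (ψ ∘ γ) t - (1 : ℝ) • v) (C := 2 * C * ‖v‖ ^ 2)
    (fun s hs => (((hdiff s (hall s hs).1).hasDerivAt).sub
      ((hasDerivAt_id s).smul_const v)).hasDerivWithinAt) (fun s hs => ?_) 1 h1
  · simpa [hc0, h0, hψ.map_one] using this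
  · obtain ⟨h1, h2⟩ := hall s (Ico_subset_Icc_self hs)
    have h3 := hψ.norm_deriv_sub_le hadd hcont hv (hdiff s h1).hasDerivAt h1 h2
    have h4 := hgrow 1 hall s (Ico_subset_Icc_self hs)
    have h5 : ‖ψ (γ s)‖ ≤ 2 * ‖v‖ := by nlinarith [hs.2, norm_nonneg v]
    rw [one_smul]
    calc _ ≤ _ := h3
      _ ≤ C * (2 * ‖v‖) * ‖v‖ := by gcongr
      _ = _ := by ring

end FirstExit

/-! ### The chart at the unit element and its estimates. -/

section LieGroup

variable {G : Type*} [TopologicalSpace G] [ChartedSpace E G] [Group G]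

variable (E G) in
/-- The preferred chart of `G` at `1`, translated so that it maps `1` to `0`. -/
def chartAtOne : OpenPartialHomeomorph G E :=
  (chartAt E (1 : G)).transHomeomorph (Homeomorph.addRight (-(chartAt E (1 : G) 1)))

omit [NormedSpace ℝ E] in
lemma chartAtOne_apply (g : G) : chartAtOne E G g = chartAt E (1 : G) g - chartAt E (1 : G) 1 := by
  simp [chartAtOne, sub_eq_add_neg]

omit [NormedSpace ℝ E] in
lemma chartAtOne_symm_apply (x : E) :
    (chartAtOne E G).symm x = (chartAt E (1 : G)).symm (x + chartAt E (1 : G) 1) := by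
  simp [chartAtOne, Homeomorph.addRight_symm]

omit [NormedSpace ℝ E] in
lemma chartAtOne_one : chartAtOne E G 1 = 0 := by simp [chartAtOne_apply]

omit [NormedSpace ℝ E] in
lemma one_mem_chartAtOne_source : (1 : G) ∈ (chartAtOne E G).source := mem_chart_source E 1

variable [LieGroup 𝓘(ℝ, E) ∞ G]

lemma contMDiffOn_chartAtOne :
    ContMDiffOn 𝓘(ℝ, E) 𝓘(ℝ, E) ∞ (chartAtOne E G) (chartAtOne E G).source := by
  have h := contMDiffOn_chart (I := 𝓘(ℝ, E)) (n := ∞) (x := (1 : G))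
  have h2 : ContMDiff 𝓘(ℝ, E) 𝓘(ℝ, E) ∞ fun x : E => x - chartAt E (1 : G) 1 :=
    (contDiff_id.sub contDiff_const).contMDiff
  exact (h2.comp_contMDiffOn h).congr fun g _ => chartAtOne_apply g

lemma contMDiffAt_chartAtOne_symm :
    ContMDiffAt 𝓘(ℝ, E) 𝓘(ℝ, E) ∞ (chartAtOne E G).symm 0 := by
  have h := (contMDiffOn_chart_symm (I := 𝓘(ℝ, E)) (n := ∞) (x := (1 : G))).contMDiffAt
    (x := 0 + chartAt E (1 : G) 1)
    ((chartAt E (1 : G)).open_target.mem_nhds (by simp))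
  have h2 : ContMDiff 𝓘(ℝ, E) 𝓘(ℝ, E) ∞ fun x : E => x + chartAt E (1 : G) 1 :=
    (contDiff_id.add contDiff_const).contMDiff
  exact (h.comp (0 : E) h2.contMDiffAt).congr_of_eventuallyEq
    (Eventually.of_forall fun x => chartAtOne_symm_apply x)

omit [LieGroup 𝓘(ℝ, E) ∞ G] in
lemma chartAtOne_symm_zero : (chartAtOne E G).symm 0 = 1 := by
  rw [← chartAtOne_one (E := E) (G := G), (chartAtOne E G).left_inv one_mem_chartAtOne_source]

/-- Read in the chart, multiplication is smooth near the origin, so its second differences are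
controlled; the radius is shrunk so that products stay in the source. -/
lemma exists_isMulChart : ∃ r C, IsMulChart (chartAtOne E G) r C := by
  have hmul : ContMDiffAt 𝓘(ℝ, E × E) 𝓘(ℝ, E) ∞
      (fun z : E × E => (chartAtOne E G).symm z.1 * (chartAtOne E G).symm z.2) 0 := by
    have h1 : ContMDiffAt 𝓘(ℝ, E × E) 𝓘(ℝ, E) ∞
        (fun z : E × E => (chartAtOne E G).symm z.1) 0 :=
      ContMDiffAt.comp (I' := 𝓘(ℝ, E)) (0 : E × E) contMDiffAt_chartAtOne_symm
        contDiff_fst.contMDiff.contMDiffAt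
    have h2 : ContMDiffAt 𝓘(ℝ, E × E) 𝓘(ℝ, E) ∞
        (fun z : E × E => (chartAtOne E G).symm z.2) 0 :=
      ContMDiffAt.comp (I' := 𝓘(ℝ, E)) (0 : E × E) contMDiffAt_chartAtOne_symm
        contDiff_snd.contMDiff.contMDiffAt
    exact h1.mul h2
  have h1 : (chartAtOne E G).symm (0 : E × E).1 * (chartAtOne E G).symm (0 : E × E).2 = 1 := by
    simp [chartAtOne_symm_zero]
  have hsrc : (chartAtOne E G).source ∈
      𝓝 ((chartAtOne E G).symm (0 : E × E).1 * (chartAtOne E G).symm (0 : E × E).2) := by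
    rw [h1]; exact (chartAtOne E G).open_source.mem_nhds one_mem_chartAtOne_source
  have hm : ContDiffAt ℝ ∞ (fun z : E × E =>
      chartAtOne E G ((chartAtOne E G).symm z.1 * (chartAtOne E G).symm z.2)) 0 :=
    contMDiffAt_iff_contDiffAt.1
      (ContMDiffAt.comp (I' := 𝓘(ℝ, E)) (0 : E × E) (contMDiffOn_chartAtOne.contMDiffAt hsrc) hmul)
  obtain ⟨r₁, hr₁, C, hC, hdd⟩ :=
    (hm.of_le (by norm_cast)).exists_norm_second_difference_le
  obtain ⟨r₂, hr₂, hball₂⟩ := Metric.nhds_basis_closedBall.mem_iff.1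
    (hmul.continuousAt.preimage_mem_nhds hsrc)
  have htgt : (chartAtOne E G).target ∈ 𝓝 (0 : E) := by
    refine (chartAtOne E G).open_target.mem_nhds ?_
    rw [← chartAtOne_one (E := E) (G := G)]
    exact (chartAtOne E G).map_source one_mem_chartAtOne_source
  obtain ⟨r₃, hr₃, hball₃⟩ := Metric.nhds_basis_closedBall.mem_iff.1 htgt
  refine ⟨min r₁ (min r₂ r₃), C, ?_⟩
  have hle₁ : min r₁ (min r₂ r₃) ≤ r₁ := min_le_left _ _
  have hle₂ : min r₁ (min r₂ r₃) ≤ r₂ := (min_le_right _ _).trans (min_le_left _ _)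
  have hle₃ : min r₁ (min r₂ r₃) ≤ r₃ := (min_le_right _ _).trans (min_le_right _ _)
  refine ⟨by positivity, hC, one_mem_chartAtOne_source, chartAtOne_one,
    (Metric.closedBall_subset_closedBall hle₃).trans hball₃, fun {g h} hg hgr hh hhr => ?_,
    fun {g g' h h'} hg hgr hg' hgr' hh hhr hh' hhr' => ?_⟩
  · have : (chartAtOne E G g, chartAtOne E G h) ∈ Metric.closedBall (0 : E × E) r₂ := by
      rw [mem_closedBall_zero_iff, Prod.norm_def]
      exact max_le (hgr.trans hle₂) (hhr.trans hle₂)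
    have := hball₂ this
    simpa only [mem_preimage, (chartAtOne E G).left_inv hg, (chartAtOne E G).left_inv hh] using this
  · have := hdd _ _ _ _ (hgr.trans hle₁) (hgr'.trans hle₁) (hhr.trans hle₁) (hhr'.trans hle₁)
    simpa only [(chartAtOne E G).left_inv hg, (chartAtOne E G).left_inv hh,
      (chartAtOne E G).left_inv hg', (chartAtOne E G).left_inv hh'] using this

variable [FiniteDimensional ℝ E] [T2Space G]

-- At time `0` the curve is at the base point of the chart, where the coordinate change is the
-- identity. At other times differentiability suffices, since `IsMulChart.norm_deriv_sub_le`
-- controls the velocity.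
omit [FiniteDimensional ℝ E] [T2Space G] in
lemma hasDerivAt_chartAtOne_comp {v : E} {γ : ℝ → G} (h0 : γ 0 = 1)
    (hγ : IsMIntegralCurve (I := 𝓘(ℝ, E)) γ (leftInvField G v)) :
    HasDerivAt (chartAtOne E G ∘ γ) v 0 := by
  have := isManifold_of_lieGroup (E := E) (G := G)
  have h := ((hγ.isMIntegralCurveAt 0).eventually_hasDerivAt).self_of_nhds
  have e : ∀ g : G, g = 1 → (leftInvField G v g : E) = v := by
    rintro _ rfl
    exact leftInvField_one v
  replace h := h.congr_deriv ((tangentCoordChange_self (mem_extChartAt_source _)).trans (e _ h0))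
  rw [h0] at h
  refine (h.sub_const (chartAt E (1 : G) 1)).congr_of_eventuallyEq (Eventually.of_forall fun t => ?_)
  simp [chartAtOne_apply]

omit [FiniteDimensional ℝ E] [T2Space G] in
lemma differentiableAt_chartAtOne_comp {v : E} {γ : ℝ → G}
    (hγ : IsMIntegralCurve (I := 𝓘(ℝ, E)) γ (leftInvField G v)) {t : ℝ}
    (ht : γ t ∈ (chartAtOne E G).source) : DifferentiableAt ℝ (chartAtOne E G ∘ γ) t := by
  have h1 : MDifferentiableAt 𝓘(ℝ, E) 𝓘(ℝ, E) (chartAtOne E G) (γ t) :=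
    (contMDiffOn_chartAtOne.contMDiffAt
      ((chartAtOne E G).open_source.mem_nhds ht)).mdifferentiableAt (by simp)
  exact (h1.comp t (hγ t).mdifferentiableAt).differentiableAt

variable (E G) in
/-- Every Lie group has a logarithmic chart. -/
theorem exists_isLogChart : ∃ ψ r C, IsLogChart (E := E) (G := G) ψ (lieExp G) r C := by
  obtain ⟨r, C, hψ⟩ := exists_isMulChart (E := E) (G := G)
  have hC := hψ.const_pos
  have hr := hψ.pos
  -- Chosen so that `C * ρ ≤ 1`; the later radius `ρ / 3` gives the strict inequality `2 * ‖v‖ < ρ`.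
  set ρ := min r (1 / C) with hρ
  have hρ0 : 0 < ρ := by positivity
  have hψρ : IsMulChart (chartAtOne E G) ρ C := hψ.mono hρ0 (min_le_left _ _) le_rfl
  have hCρ : C * ρ ≤ 1 := by
    calc C * ρ ≤ C * (1 / C) := by gcongr; exact min_le_right _ _
      _ = 1 := by field_simp
  have hexp : ∀ v : E, ‖v‖ ≤ ρ / 3 → lieExp G v ∈ (chartAtOne E G).source ∧
      ‖chartAtOne E G (lieExp G v) - v‖ ≤ 2 * C * ‖v‖ ^ 2 := by
    intro v hv
    obtain ⟨γ, h0, hγ⟩ := exists_isMIntegralCurve_leftInvField (G := G) v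
    rw [lieExp_eq h0 hγ]
    exact hψρ.norm_oneParam_sub_le hCρ (leftInvField_curve_add h0 hγ) hγ.continuous
      (fun t ht => differentiableAt_chartAtOne_comp hγ ht) (hasDerivAt_chartAtOne_comp h0 hγ)
      (by linarith)
  exact ⟨chartAtOne E G, ρ / 3, 2 * C,
    { hψρ.mono (r' := ρ / 3) (C' := 2 * C) (by linarith) (by linarith) (by linarith) with
      exp_mem := fun hv => (hexp _ hv).1
      norm_exp_sub_le := fun hv => (hexp _ hv).2 }⟩

end LieGroup

end LogChartExists

/-! ### Multiplicative integrals -/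

section MultInt

variable {V : Type*} [NormedAddCommGroup V] [NormedSpace ℝ V]
  {E : Type*} [NormedAddCommGroup E] [NormedSpace ℝ E]
  (G : Type*) [TopologicalSpace G] [ChartedSpace E G] [Group G]

/-- The coefficient of the pullback of `α` along the path `σ`. -/
def pathCoeff (α : V → V → E) (σ : ℝ → V) : ℝ → E :=
  smoothCoeff (pullbackForm σ (ContinuousLinearMap.id ℝ E) α)

lemma refinedRP_succ (k : ℕ) (α : V → V → E) (σ : ℝ → V) :
    refinedRP G (k + 1) α σ = refinedRP G k α (σ ∘ fun t : ℝ => t / 2) *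
      refinedRP G k α (σ ∘ fun t : ℝ => (1 + t) / 2) := by
  simp [refinedRP, tessellation, Function.comp_def]

variable [FiniteDimensional ℝ E] [T2Space G] [LieGroup 𝓘(ℝ, E) ∞ G]

/-- The default factor `1` at a non-smooth midpoint is the exponential of the default coefficient
`0`. -/
lemma refinedRP_eq_dyadicProd (k : ℕ) (α : V → V → E) (σ : ℝ → V) :
    refinedRP G k α σ = dyadicProd (lieExp G) k (pathCoeff α σ) := by
  induction k generalizing σ with
  | zero =>
    by_cases h : IsSmoothPoint (pullbackForm σ (ContinuousLinearMap.id ℝ E) α) (1 / 2)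
    · simp only [refinedRP, tessellation, List.map_cons, List.map_nil, List.prod_singleton,
        Function.comp_id, basicRP, basicRPSegment, dyadicProd, pathCoeff, smoothCoeff, if_pos h]
    · simp only [refinedRP, tessellation, List.map_cons, List.map_nil, List.prod_singleton,
        Function.comp_id, basicRP, basicRPSegment, dyadicProd, pathCoeff, smoothCoeff, if_neg h,
        lieExp_zero]
  | succ k ih =>
    rw [refinedRP_succ, ih, ih, dyadicProd]
    exact congrArg₂ (· * ·) (dyadicProd_congr _ k (smoothCoeff_comp_leftHalf σ α))
      (dyadicProd_congr _ k (smoothCoeff_comp_rightHalf σ α))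

/-- The coefficient of `α` along `σ` is bounded, and continuous off a finite set. -/
def HasRegularCoeff (α : V → V → E) (σ : ℝ → V) : Prop :=
  ∃ M, AlmostEqual M (pathCoeff α σ) (pathCoeff α σ)

variable {G}

-- Regularity passes to halves directly, so inductions over subdivisions need not show that the
-- halves are piecewise linear.
omit [FiniteDimensional ℝ E] in
lemma HasRegularCoeff.left {α : V → V → E} {σ : ℝ → V} (h : HasRegularCoeff α σ) :
    HasRegularCoeff α (σ ∘ fun t : ℝ => t / 2) := by
  obtain ⟨M, h⟩ := h
  exact ⟨_, h.left.congr (smoothCoeff_comp_leftHalf σ α).symm⟩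

omit [FiniteDimensional ℝ E] in
lemma HasRegularCoeff.right {α : V → V → E} {σ : ℝ → V} (h : HasRegularCoeff α σ) :
    HasRegularCoeff α (σ ∘ fun t : ℝ => (1 + t) / 2) := by
  obtain ⟨M, h⟩ := h
  exact ⟨_, h.right.congr (smoothCoeff_comp_rightHalf σ α).symm⟩

variable (G)

lemma tendsto_refinedRP {α : V → V → E} {σ : ℝ → V} (h : HasRegularCoeff α σ) :
    Tendsto (fun k => refinedRP G k α σ) atTop (𝓝 (multInt G α σ)) := by
  have := topologicalGroup_of_lieGroup 𝓘(ℝ, E) ∞ (G := G)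
  have := FiniteDimensional.complete ℝ E
  obtain ⟨ψ, r, C, hψ⟩ := exists_isLogChart E G
  obtain ⟨M, h⟩ := h
  obtain ⟨g, hg, -⟩ := hψ.exists_tendsto_dyadicProd h
  simp only [← refinedRP_eq_dyadicProd] at hg
  exact tendsto_nhds_limUnder ⟨g, hg⟩

lemma multInt_eq_mul {α : V → V → E} {σ : ℝ → V} (h : HasRegularCoeff α σ) :
    multInt G α σ = multInt G α (σ ∘ fun t : ℝ => t / 2) *
      multInt G α (σ ∘ fun t : ℝ => (1 + t) / 2) := by
  have := topologicalGroup_of_lieGroup 𝓘(ℝ, E) ∞ (G := G)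
  have h1 := (tendsto_add_atTop_iff_nat 1).2 (tendsto_refinedRP G h)
  simp only [refinedRP_succ] at h1
  exact tendsto_nhds_unique h1 ((tendsto_refinedRP G h.left).mul (tendsto_refinedRP G h.right))

lemma multInt_eq_prod_tessellation (k : ℕ) {α : V → V → E} {σ : ℝ → V}
    (h : HasRegularCoeff α σ) :
    multInt G α σ = ((tessellation k).map fun ρ => multInt G α (σ ∘ ρ)).prod := by
  induction k generalizing σ with
  | zero => simp [tessellation]
  | succ k ih =>
    rw [multInt_eq_mul G h, ih h.left, ih h.right]
    simp [tessellation, Function.comp_def]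

/-- Inversion holds exactly for every Riemann product, and is continuous. -/
lemma multInt_comp_flipSegment {α : V → V → E} {σ : ℝ → V} (h : HasRegularCoeff α σ) :
    multInt G α (σ ∘ flipSegment) = (multInt G α σ)⁻¹ := by
  have := topologicalGroup_of_lieGroup 𝓘(ℝ, E) ∞ (G := G)
  have h1 : ∀ k, refinedRP G k α (σ ∘ flipSegment) = (refinedRP G k α σ)⁻¹ := fun k => by
    rw [refinedRP_eq_dyadicProd, refinedRP_eq_dyadicProd, ← dyadicProd_flip lieExp_neg]
    exact dyadicProd_congr _ k (smoothCoeff_comp_flipSegment σ α)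
  have h2 := (tendsto_refinedRP G h).inv
  simp only [← h1] at h2
  exact h2.limUnder_eq

omit [FiniteDimensional ℝ E] [T2Space G] [LieGroup 𝓘(ℝ, E) ∞ G] in
lemma multIntString_append (α : V → V → E) (L M : List (ℝ → V)) :
    multIntString G α (L ++ M) = multIntString G α L * multIntString G α M := by
  simp [multIntString]

lemma multIntString_inverseString {α : V → V → E} {L : List (ℝ → V)}
    (h : ∀ σ ∈ L, HasRegularCoeff α σ) :
    multIntString G α (inverseString L) = (multIntString G α L)⁻¹ := by
  rw [multIntString, multIntString, List.prod_inv_reverse, inverseString, List.map_reverse,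
    List.map_map, List.map_map]
  congr 2
  exact List.map_congr_left fun σ hσ => multInt_comp_flipSegment G (h σ hσ)

/-- A homomorphism of Lie groups maps the multiplicative integral of `α` along `σ` to that of `β`
along `τ`, if its derivative maps the coefficients of `α` to those of `β`, up to finitely many
points. -/
lemma tendsto_refinedRP_map {E' : Type*} [NormedAddCommGroup E'] [NormedSpace ℝ E']
    [FiniteDimensional ℝ E'] {H : Type*} [TopologicalSpace H] [T2Space H] [ChartedSpace E' H]
    [Group H] [LieGroup 𝓘(ℝ, E') ∞ H] {W : Type*} [NormedAddCommGroup W] [NormedSpace ℝ W]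
    {Φ : G →* H} (hΦ : ContMDiff 𝓘(ℝ, E) 𝓘(ℝ, E') ∞ Φ)
    {α : V → V → E} {σ : ℝ → V} {β : W → W → E'} {τ : ℝ → W} (h : HasRegularCoeff α σ)
    (hβ : ∃ M, AlmostEqual M (fun t => lieMap E E' Φ (pathCoeff α σ t)) (pathCoeff β τ)) :
    Tendsto (fun k => refinedRP H k β τ) atTop (𝓝 (multInt H β τ)) ∧
      Φ (multInt G α σ) = multInt H β τ := by
  have := topologicalGroup_of_lieGroup 𝓘(ℝ, E') ∞ (G := H)
  have := FiniteDimensional.complete ℝ E'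
  obtain ⟨ψ, r, C, hψ⟩ := exists_isLogChart E' H
  obtain ⟨M, hβ⟩ := hβ
  obtain ⟨g, hg1, hg2⟩ := hψ.exists_tendsto_dyadicProd hβ
  simp only [← refinedRP_eq_dyadicProd] at hg2
  simp only [← map_dyadicProd Φ (lieMap E E' Φ) (map_lieExp (hΦ.mdifferentiable (by simp))),
    ← refinedRP_eq_dyadicProd] at hg1
  have h3 := (hΦ.continuous.tendsto _).comp (tendsto_refinedRP G h)
  exact ⟨tendsto_nhds_limUnder ⟨g, hg2⟩, (tendsto_nhds_unique h3 hg1).trans hg2.limUnder_eq.symm⟩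

end MultInt

end

theorem mainTheorem10
    {E : Type*} [NormedAddCommGroup E] [NormedSpace ℝ E] [FiniteDimensional ℝ E]
    {G : Type*} [TopologicalSpace G] [T2Space G] [ChartedSpace E G] [Group G]
    [LieGroup 𝓘(ℝ, E) ∞ G]
    {V : Type*} [NormedAddCommGroup V] [NormedSpace ℝ V] [FiniteDimensional ℝ V]
    (X : Set V) (hX : IsPolyhedron X)
    (α : V → V → E) (hα : IsPiecewiseSmoothForm X α) :
    -- the Riemann products converge
    (∀ σ : ℝ → V, IsPLMap unitSegment X σ →
      Tendsto (fun k => refinedRP G k α σ) atTop (𝓝 (multInt G α σ))) ∧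
    -- multiplicativity under binary subdivision
    (∀ σ : ℝ → V, IsPLMap unitSegment X σ → ∀ k : ℕ,
      multInt G α σ = ((tessellation k).map fun ρ => multInt G α (σ ∘ ρ)).prod) ∧
    -- multiplicativity under concatenation of strings
    (∀ L M : List (ℝ → V), IsString X L → IsString X M →
      (∀ σ ∈ L.getLast?, ∀ τ ∈ M.head?, σ 1 = τ 0) →
      multIntString G α (L ++ M) = multIntString G α L * multIntString G α M) ∧
    -- reversal of paths and of strings
    (∀ σ : ℝ → V, IsPLMap unitSegment X σ →
      multInt G α (σ ∘ flipSegment) = (multInt G α σ)⁻¹) ∧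
    (∀ L : List (ℝ → V), IsString X L →
      multIntString G α (inverseString L) = (multIntString G α L)⁻¹) ∧
    -- functoriality in the group and in the polyhedron
    (∀ (E' : Type*) [NormedAddCommGroup E'] [NormedSpace ℝ E'] [FiniteDimensional ℝ E']
      (H : Type*) [TopologicalSpace H] [T2Space H] [ChartedSpace E' H] [Group H]
      [LieGroup 𝓘(ℝ, E') ∞ H]
      (W : Type*) [NormedAddCommGroup W] [NormedSpace ℝ W] [FiniteDimensional ℝ W]
      (Φ : G →* H), ContMDiff 𝓘(ℝ, E) 𝓘(ℝ, E') ∞ Φ →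
      ∀ Y : Set W, IsPolyhedron Y → ∀ f : W → V, IsPLMap Y X f →
      (∀ σ : ℝ → W, IsPLMap unitSegment Y σ →
        Tendsto (fun k => refinedRP H k (pullbackForm f (lieMap E E' Φ) α) σ) atTop
          (𝓝 (multInt H (pullbackForm f (lieMap E E' Φ) α) σ)) ∧
        Φ (multInt G α (f ∘ σ)) = multInt H (pullbackForm f (lieMap E E' Φ) α) σ) ∧
      (∀ L : List (ℝ → W), IsString Y L →
        Φ (multIntString G α (L.map fun σ => f ∘ σ)) =
          multIntString H (pullbackForm f (lieMap E E' Φ) α) L)) := by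
  have hreg : ∀ σ : ℝ → V, IsPLMap unitSegment X σ → HasRegularCoeff α σ := fun σ hσ =>
    exists_almostEqual_pullbackForm hα hσ
  refine ⟨fun σ hσ => tendsto_refinedRP G (hreg σ hσ),
    fun σ hσ k => multInt_eq_prod_tessellation G k (hreg σ hσ),
    fun L M _ _ _ => multIntString_append G α L M,
    fun σ hσ => multInt_comp_flipSegment G (hreg σ hσ),
    fun L hL => multIntString_inverseString G fun σ hσ => hreg σ (hL.1 σ hσ), ?_⟩
  intro E' _ _ _ H _ _ _ _ _ W _ _ _ Φ hΦ Y _ f hf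
  have key : ∀ σ : ℝ → W, IsPLMap unitSegment Y σ →
      Tendsto (fun k => refinedRP H k (pullbackForm f (lieMap E E' Φ) α) σ) atTop
        (𝓝 (multInt H (pullbackForm f (lieMap E E' Φ) α) σ)) ∧
      Φ (multInt G α (f ∘ σ)) = multInt H (pullbackForm f (lieMap E E' Φ) α) σ := fun σ hσ =>
    have h := exists_almostEqual_comp hα hf (lieMap E E' Φ) hσ
    tendsto_refinedRP_map G hΦ h.1 h.2
  refine ⟨key, fun L hL => ?_⟩
  rw [multIntString, multIntString, map_list_prod, List.map_map, List.map_map]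
  congr 1
  exact List.map_congr_left fun σ hσ => (key σ (hL.1 σ hσ)).2
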